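/- Let $\mathbb{D}=\{z\in\mathbb{C}:|z|\le 1\}$ be the closed unit disk, $z=\rho e^{i\omega}$, $x=1-\rho^2$, let $dV=\rho\,d\rho\,d\omega$ be Lebesgue measure, and let $\gamma\in\mathbb{R}$. Let $$\mathcal{L}_\gamma=-\rho^{-1}x^{-\gamma}\partial_\rho(\rho x^{\gamma+1}\partial_\rho)-\rho^{-2}\partial_\omega^2+(1+\gamma)^2=-x\Delta+(2+2\gamma)\rho\partial_\rho-\partial_\omega^2+(\gamma+1)^2,$$ and let $L^2_\gamma=L^2(\mathbb{D},x^\gamma dV)$ be the complex Hilbert space with inner product $(f,g)=\int_{\mathbb{D}}f\bar g\,x^\gamma dV$. Let $\dot C^\infty(\mathbb{D})$ be the space of complex-valued smooth functions on $\mathbb{D}$ all of whose derivatives (of all orders, including zero) vanish on $\partial\mathbb{D}$, and let $C_c^\infty(\mathbb{D}^{int})$ be the space of complex-valued smooth functions with compact support in the open disk. Suppose that $|\gamma|\ge 1$. Then $\dot C^\infty(\mathbb{D})$ and $\mathcal{L}_\gamma(\dot C^\infty(\mathbb{D}))$ are contained in $L^2_\gamma$, the operator $(\mathcal{L}_\gamma,\dot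 C^\infty(\mathbb{D}))$ in $L^2_\gamma$ is closable, and its closure, the minimal operator $\mathcal{L}_{\gamma,min}$, is self-adjoint. Moreover: (a) The operator $T=(\mathcal{L}_\gamma,C_c^\infty(\mathbb{D}^{int}))$ is densely defined, symmetric and nonnegative, and $\mathcal{L}_{\gamma,min}$ is equal to its Friedrichs extension $\mathcal{L}_{\gamma,D}$. Here, with $\alpha(u,v)=(Tu,v)$, let $V$ be the set of those $u\in L^2_\gamma$ for which there are $u_n\in C_c^\infty(\mathbb{D}^{int})$ with $u_n\to u$ in $L^2_\gamma$ and $\alpha(u_n-u_m,u_n-u_m)\to 0$ as $m,n\to\infty$, and let $\tilde\alpha$ be the extension of $\alpha$ to $V$ by continuity; then $u\in\mathrm{dom}(\mathcal{L}_{\gamma,D})$ and $\mathcal{L}_{\gamma,D}u=w$ if and only if $u\in V$ and $\tilde\alpha(u,v)=(w,v)$ for all $v\in V$. (b) $\mathcal{L}_{\gamma,min}$ is the only self-adjoint operator in $L^2_\gamma$ that extends $(\mathcal{L}_\gamma,\dot C^\infty(\mathbb{D}))$. -/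

import Mathlib

open Filter Topology MeasureTheory Metric
open scoped ContDiff InnerProductSpace

noncomputable section

namespace DiskOperator

/-! ### The differential expression on the unit disk

The plane is `ℂ`, regarded as a real vector space, with `z = ρ e^{iω}` and `x = 1 - ρ²`. -/

/-- The boundary defining function `x = 1 - ρ² = 1 - |z|²`. -/
def bdf (z : ℂ) : ℝ := 1 - ‖z‖ ^ 2

/-- The radial vector field `ρ ∂_ρ`, whose value at `z` is the vector `z`. -/
def radial (f : ℂ → ℂ) (z : ℂ) : ℂ := fderiv ℝ f z z

/-- The angular vector field `∂_ω`, whose value at `z` is the vector `i z`. -/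
def angular (f : ℂ → ℂ) (z : ℂ) : ℂ := fderiv ℝ f z (Complex.I * z)

/-- The operator `L_γ = -x Δ + (2 + 2γ) ρ ∂_ρ - ∂_ω² + (γ + 1)²`.
This is the smooth extension across the origin of
`-ρ⁻¹ x^{-γ} ∂_ρ (ρ x^{γ+1} ∂_ρ) - ρ⁻² ∂_ω² + (1 + γ)²`; see `diskOp_polar`. -/
def diskOp (γ : ℝ) (f : ℂ → ℂ) (z : ℂ) : ℂ :=
  -(bdf z : ℂ) * Laplacian.laplacian f z + ((2 + 2 * γ : ℝ) : ℂ) * radial f z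
    - angular (angular f) z + (((γ + 1) ^ 2 : ℝ) : ℂ) * f z

section Calculus

variable {f g : ℂ → ℂ} {z : ℂ}

theorem angular_differentiableAt (hf : ContDiffAt ℝ ∞ f z) :
    DifferentiableAt ℝ (angular f) z := by
  have h1 : ContDiffAt ℝ 1 (fderiv ℝ f) z := hf.fderiv_right (by norm_cast)
  exact (h1.differentiableAt (by simp)).clm_apply (by fun_prop)

theorem eventually_contDiffAt (hf : ContDiffAt ℝ ∞ f z) :
    ∀ᶠ y in 𝓝 z, DifferentiableAt ℝ f y := by
  have h2 : ContDiffAt ℝ 1 f z := hf.of_le (by norm_cast)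
  filter_upwards [h2.eventually (by simp)] with y hy
  exact hy.differentiableAt (by simp)

theorem diskOp_add (γ : ℝ) (hf : ContDiffAt ℝ ∞ f z) (hg : ContDiffAt ℝ ∞ g z) :
    diskOp γ (f + g) z = diskOp γ f z + diskOp γ g z := by
  have hf2 : ContDiffAt ℝ 2 f z := hf.of_le (by norm_cast)
  have hg2 : ContDiffAt ℝ 2 g z := hg.of_le (by norm_cast)
  have hE : angular (f + g) =ᶠ[𝓝 z] angular f + angular g := by
    filter_upwards [eventually_contDiffAt hf, eventually_contDiffAt hg] with y h1 h2
    simp [angular, fderiv_add h1 h2]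
  have hA : angular (angular (f + g)) z = angular (angular f) z + angular (angular g) z := by
    rw [angular, hE.fderiv_eq, fderiv_add (angular_differentiableAt hf)
      (angular_differentiableAt hg)]
    rfl
  have hR : radial (f + g) z = radial f z + radial g z := by
    simp [radial, fderiv_add (hf2.differentiableAt (by simp)) (hg2.differentiableAt (by simp))]
  simp only [diskOp, hA, hR, hf2.laplacian_add hg2, Pi.add_apply]
  ring

theorem diskOp_smul (γ : ℝ) (c : ℂ) (hf : ContDiffAt ℝ ∞ f z) :
    diskOp γ (c • f) z = c * diskOp γ f z := by
  have hf2 : ContDiffAt ℝ 2 f z := hf.of_le (by norm_cast)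
  have hE : angular (c • f) =ᶠ[𝓝 z] c • angular f := by
    filter_upwards [eventually_contDiffAt hf] with y h1
    simp [angular, fderiv_const_smul h1]
  have hA : angular (angular (c • f)) z = c * angular (angular f) z := by
    rw [angular, hE.fderiv_eq, fderiv_const_smul (angular_differentiableAt hf)]
    rfl
  have hR : radial (c • f) z = c * radial f z := by
    simp [radial, fderiv_const_smul (hf2.differentiableAt (by simp))]
  simp only [diskOp, hA, hR, InnerProductSpace.laplacian_smul c hf2, Pi.smul_apply, smul_eq_mul]
  ring

theorem diskOp_eq_zero (γ : ℝ) (hf : f =ᶠ[𝓝 z] 0) : diskOp γ f z = 0 := by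
  have h0 : diskOp γ f z = diskOp γ 0 z := by
    have hE : angular f =ᶠ[𝓝 z] angular 0 := by
      filter_upwards [hf.eventuallyEq_nhds] with y hy
      simp [angular, hy.fderiv_eq]
    have hA : angular (angular f) z = angular (angular 0) z := by
      rw [angular, hE.fderiv_eq]; rfl
    have hR : radial f z = radial 0 z := by rw [radial, hf.fderiv_eq]; rfl
    simp only [diskOp, hA, hR, hf.eq_of_nhds,
      (InnerProductSpace.laplacian_congr_nhds hf).eq_of_nhds]
  rw [h0]
  have h1 := diskOp_smul (z := z) γ 0 (f := 0) contDiffAt_const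
  simpa using h1

/-- In polar coordinates `z = ρ e^{iω}` (with `ω = θ₀`), `0 < ρ < 1`, with `x = 1 - ρ²`, one has
`L_γ = -ρ⁻¹ x^{-γ} ∂_ρ (ρ x^{γ+1} ∂_ρ) - ρ⁻² ∂_ω² + (1 + γ)²`. -/
theorem diskOp_polar (γ : ℝ) (hf : ContDiffOn ℝ ∞ f (ball 0 1)) {ρ : ℝ} (h0 : 0 < ρ)
    (h1 : ρ < 1) (θ₀ : ℝ) :
    diskOp γ f (ρ * Complex.exp (θ₀ * Complex.I)) =
      -((ρ⁻¹ * (1 - ρ ^ 2) ^ (-γ) : ℝ) : ℂ) *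
          deriv (fun r : ℝ => ((r * (1 - r ^ 2) ^ (γ + 1) : ℝ) : ℂ) *
            deriv (fun s : ℝ => f (s * Complex.exp (θ₀ * Complex.I))) r) ρ
        - ((ρ ^ 2)⁻¹ : ℝ) * deriv (deriv fun θ : ℝ => f (ρ * Complex.exp (θ * Complex.I))) θ₀
        + (((1 + γ) ^ 2 : ℝ) : ℂ) * f (ρ * Complex.exp (θ₀ * Complex.I)) := by
  set e : ℂ := Complex.exp (θ₀ * Complex.I) with he
  have hen : ‖e‖ = 1 := Complex.norm_exp_ofReal_mul_I θ₀
  have hnorm : ∀ θ : ℝ, ‖(ρ : ℂ) * Complex.exp (θ * Complex.I)‖ = ρ := fun θ => by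
    rw [norm_mul, Complex.norm_exp_ofReal_mul_I, mul_one, Complex.norm_real, Real.norm_of_nonneg h0.le]
  have hcd : ∀ y ∈ ball (0 : ℂ) 1, ContDiffAt ℝ ∞ f y := fun y hy =>
    hf.contDiffAt (isOpen_ball.mem_nhds hy)
  have hmem : ∀ θ : ℝ, (ρ : ℂ) * Complex.exp (θ * Complex.I) ∈ ball (0 : ℂ) 1 := fun θ => by
    rw [mem_ball_zero_iff, hnorm θ]; exact h1
  have hz := hmem θ₀
  rw [← he] at hz
  have hx : 0 < 1 - ρ ^ 2 := by nlinarith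
  -- the angular part
  have hang : ∀ (g : ℂ → ℂ) (θ : ℝ),
      DifferentiableAt ℝ g (ρ * Complex.exp (θ * Complex.I)) →
      deriv (fun θ : ℝ => g (ρ * Complex.exp (θ * Complex.I))) θ =
        angular g (ρ * Complex.exp (θ * Complex.I)) := by
    intro g θ hg
    have hc : HasDerivAt (fun θ : ℝ => (ρ : ℂ) * Complex.exp (θ * Complex.I))
        (Complex.I * (ρ * Complex.exp (θ * Complex.I))) θ := by
      have := (((Complex.ofRealCLM.hasDerivAt (x := θ)).mul_const Complex.I).cexp).const_mul (ρ : ℂ)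
      refine this.congr_deriv ?_
      simp
      ring
    exact (hg.hasFDerivAt.comp_hasDerivAt θ hc).deriv
  have hang1 : (deriv fun θ : ℝ => f (ρ * Complex.exp (θ * Complex.I))) =
      fun θ : ℝ => angular f (ρ * Complex.exp (θ * Complex.I)) :=
    funext fun θ => hang f θ ((hcd _ (hmem θ)).differentiableAt (by simp))
  have hang2 := hang (angular f) θ₀ (angular_differentiableAt (hcd _ (hmem θ₀)))
  rw [hang1, hang2, ← he]
  set z : ℂ := ρ * e with hzdef
  have hD : DifferentiableAt ℝ (fderiv ℝ f) z := by
    have h1 : ContDiffAt ℝ 1 (fderiv ℝ f) z := (hcd z hz).fderiv_right (by norm_cast)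
    exact h1.differentiableAt (by simp)
  set B := fderiv ℝ (fderiv ℝ f) z with hB
  set D := fderiv ℝ f z with hDz
  have hAA : angular (angular f) z = B (Complex.I * z) (Complex.I * z) - D z := by
    have h2 : HasFDerivAt (fun y : ℂ => Complex.I * y)
        (ContinuousLinearMap.mul ℝ ℂ Complex.I) z :=
      (ContinuousLinearMap.mul ℝ ℂ Complex.I).hasFDerivAt
    have h3 := hD.hasFDerivAt.clm_apply h2
    have h4 : fderiv ℝ (angular f) z = _ := h3.fderiv
    rw [angular, h4]
    simp only [add_apply, ContinuousLinearMap.comp_apply,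
      ContinuousLinearMap.flip_apply, ContinuousLinearMap.mul_apply']
    rw [← mul_assoc, Complex.I_mul_I, neg_one_mul, map_neg]
    ring
  -- the radial part
  have hlin : ∀ r : ℝ, HasDerivAt (fun s : ℝ => (s : ℂ) * e) e r := fun r => by
    simpa using (Complex.ofRealCLM.hasDerivAt (x := r)).mul_const e
  have hrad : (fun r : ℝ => deriv (fun s : ℝ => f (s * e)) r) =ᶠ[𝓝 ρ]
      fun r : ℝ => fderiv ℝ f (r * e) e := by
    have hnear : ∀ᶠ r : ℝ in 𝓝 ρ, (r : ℂ) * e ∈ ball (0 : ℂ) 1 :=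
      (hlin ρ).continuousAt.eventually (isOpen_ball.mem_nhds hz)
    filter_upwards [hnear] with r hr
    exact (((hcd _ hr).differentiableAt (by simp)).hasFDerivAt.comp_hasDerivAt r (hlin r)).deriv
  have hrad2 : HasDerivAt (fun r : ℝ => deriv (fun s : ℝ => f (s * e)) r) (B e e) ρ := by
    have h5 : HasDerivAt (fun r : ℝ => fderiv ℝ f (r * e)) (B e) ρ :=
      hD.hasFDerivAt.comp_hasDerivAt ρ (hlin ρ)
    have h6 := h5.clm_apply (hasDerivAt_const ρ e)
    refine HasDerivAt.congr_of_eventuallyEq ?_ hrad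
    simpa using h6
  have hw : HasDerivAt (fun r : ℝ => r * (1 - r ^ 2) ^ (γ + 1))
      ((1 - ρ ^ 2) ^ (γ + 1) - 2 * ρ ^ 2 * (γ + 1) * (1 - ρ ^ 2) ^ γ) ρ := by
    have h7 : HasDerivAt (fun r : ℝ => 1 - r ^ 2) (-(2 * ρ)) ρ := by
      simpa using (hasDerivAt_pow 2 ρ).const_sub 1
    have h8 := (hasDerivAt_id ρ).mul (h7.rpow_const (p := γ + 1) (Or.inl hx.ne'))
    refine h8.congr_deriv ?_
    simp
    ring
  have hprod := (hw.ofReal_comp.mul hrad2).deriv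
  have hval : deriv (fun s : ℝ => f (s * e)) ρ = D e := hrad.eq_of_nhds
  have hprod' : deriv (fun r : ℝ => ((r * (1 - r ^ 2) ^ (γ + 1) : ℝ) : ℂ) *
      deriv (fun s : ℝ => f (s * e)) r) ρ =
      (((1 - ρ ^ 2) ^ (γ + 1) - 2 * ρ ^ 2 * (γ + 1) * (1 - ρ ^ 2) ^ γ : ℝ) : ℂ) * D e +
        ((ρ * (1 - ρ ^ 2) ^ (γ + 1) : ℝ) : ℂ) * B e e := by
    rw [← hval]; exact hprod
  rw [hprod']
  -- the Laplacian
  have hsc : ∀ (a : ℝ) (y : ℂ), (a : ℂ) * y = a • y := fun a y => by simp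
  have hLap : Laplacian.laplacian f z = B e e + B (Complex.I * e) (Complex.I * e) := by
    rw [InnerProductSpace.laplacian_eq_iteratedFDeriv_complexPlane]
    simp only [iteratedFDeriv_two_apply, Matrix.cons_val_zero, Matrix.cons_val_one, ← hB]
    have hab : e.re ^ 2 + e.im ^ 2 = 1 := by
      have := Complex.sq_norm e
      rw [hen, Complex.normSq_apply] at this
      nlinarith
    have e1 : e = e.re • (1 : ℂ) + e.im • Complex.I := by
      simp [Complex.re_add_im]
    have e2 : Complex.I * e = (-e.im) • (1 : ℂ) + e.re • Complex.I := by
      apply Complex.ext <;> simp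
    have e3 : B e e = B (e.re • (1 : ℂ) + e.im • Complex.I)
        (e.re • (1 : ℂ) + e.im • Complex.I) := by rw [← e1]
    rw [e2, e3]
    simp only [map_add, map_smul, add_apply, smul_apply]
    simp only [Complex.real_smul]
    have hab' : (e.re : ℂ) ^ 2 + (e.im : ℂ) ^ 2 = 1 := by exact_mod_cast hab
    push_cast
    linear_combination (-(B 1 1 + B Complex.I Complex.I)) * hab'
  have hIz : B (Complex.I * z) (Complex.I * z) = (ρ : ℂ) ^ 2 * B (Complex.I * e) (Complex.I * e) := by
    have : Complex.I * z = ρ • (Complex.I * e) := by rw [hzdef, ← hsc]; ring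
    rw [this, map_smul, map_smul, smul_apply, ← hsc, ← hsc]
    ring
  have hDe : D z = (ρ : ℂ) * D e := by rw [hzdef, hsc, map_smul, hsc]
  have hbdf : bdf z = 1 - ρ ^ 2 := by rw [bdf, hzdef, he, hnorm]
  have hpow : (1 - ρ ^ 2) ^ (γ + 1) = (1 - ρ ^ 2) ^ γ * (1 - ρ ^ 2) := Real.rpow_add_one hx.ne' γ
  have hneg : (1 - ρ ^ 2) ^ (-γ) = ((1 - ρ ^ 2) ^ γ)⁻¹ := Real.rpow_neg hx.le γ
  have hX : (((1 - ρ ^ 2) ^ γ : ℝ) : ℂ) ≠ 0 := by exact_mod_cast (Real.rpow_pos_of_pos hx γ).ne'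
  have hρ : (ρ : ℂ) ≠ 0 := by exact_mod_cast h0.ne'
  rw [diskOp, radial, hAA, hIz, ← hDz, hDe, hLap, hbdf, hpow, hneg]
  generalize (1 - ρ ^ 2) ^ γ = X at hX ⊢
  push_cast
  field_simp
  ring

end Calculus

/-! ### The Hilbert space `L²(𝔻, x^γ dV)` -/

/-- The measure `x^γ dV` on the unit disk. The unit circle is a null set for the Lebesgue measure,
so that the open disk carries the whole measure. -/
def diskMeasure (γ : ℝ) : Measure ℂ :=
  (volume.restrict (ball (0 : ℂ) 1)).withDensity fun z => ENNReal.ofReal (bdf z ^ γ)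

/-- The Hilbert space `L²_γ = L²(𝔻, x^γ dV)` of complex-valued functions. -/
abbrev DiskL2 (γ : ℝ) : Type := Lp ℂ 2 (diskMeasure γ)

theorem ae_diskMeasure_iff (γ : ℝ) (p : ℂ → Prop) :
    (∀ᵐ z ∂diskMeasure γ, p z) ↔ ∀ᵐ z ∂volume.restrict (ball (0 : ℂ) 1), p z := by
  have hm : Measurable fun z : ℂ => ENNReal.ofReal (bdf z ^ γ) := by
    unfold bdf; fun_prop
  rw [diskMeasure, ae_withDensity_iff hm]
  refine eventually_congr ?_
  filter_upwards [ae_restrict_mem measurableSet_ball] with z hz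
  have hz1 : ‖z‖ < 1 := by simpa using hz
  have hx : 0 < bdf z := by
    unfold bdf; nlinarith [norm_nonneg z]
  simp [Real.rpow_pos_of_pos hx γ]

/-! ### Spaces of smooth functions on the disk -/

/-- `C^∞(𝔻^{int})`: functions that are smooth in the open unit disk. The values of the function
outside the open disk are irrelevant. -/
def smoothInterior : Submodule ℂ (ℂ → ℂ) where
  carrier := {f | ContDiffOn ℝ ∞ f (ball 0 1)}
  zero_mem' := contDiffOn_const
  add_mem' hf hg := ContDiffOn.add hf hg
  smul_mem' c _ hf := ContDiffOn.const_smul c hf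

/-- `Ċ^∞(𝔻)`: functions that are smooth on the closed unit disk (up to and including the boundary)
and all of whose derivatives, of every order `n ≥ 0`, vanish on the unit circle. -/
def smoothFlat : Submodule ℂ (ℂ → ℂ) where
  carrier := {f | ContDiffOn ℝ ∞ f (closedBall 0 1) ∧
    ∀ (n : ℕ) (z : ℂ), ‖z‖ = 1 → iteratedFDerivWithin ℝ n f (closedBall 0 1) z = 0}
  zero_mem' := by
    refine ⟨contDiffOn_const, fun n z _ => ?_⟩
    have h : iteratedFDerivWithin ℝ n (0 : ℂ → ℂ) (closedBall 0 1) = 0 :=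
      iteratedFDerivWithin_fun_zero
    rw [h, Pi.zero_apply]
  add_mem' := by
    rintro f g ⟨hf, hf'⟩ ⟨hg, hg'⟩
    refine ⟨hf.add hg, fun n z hz => ?_⟩
    have hzm : z ∈ closedBall (0 : ℂ) 1 := by simp [hz]
    have hU : UniqueDiffOn ℝ (closedBall (0 : ℂ) 1) :=
      uniqueDiffOn_convex (convex_closedBall _ _) ⟨0, by simp [interior_closedBall]⟩
    have hn : ((n : ℕ∞) : WithTop ℕ∞) ≤ ∞ := by exact_mod_cast le_top
    rw [iteratedFDerivWithin_add_apply ((hf z hzm).of_le hn) ((hg z hzm).of_le hn) hU hzm,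
      hf' n z hz, hg' n z hz, add_zero]
  smul_mem' := by
    rintro c f ⟨hf, hf'⟩
    refine ⟨hf.const_smul c, fun n z hz => ?_⟩
    have hzm : z ∈ closedBall (0 : ℂ) 1 := by simp [hz]
    have hU : UniqueDiffOn ℝ (closedBall (0 : ℂ) 1) :=
      uniqueDiffOn_convex (convex_closedBall _ _) ⟨0, by simp [interior_closedBall]⟩
    have hn : ((n : ℕ∞) : WithTop ℕ∞) ≤ ∞ := by exact_mod_cast le_top
    rw [iteratedFDerivWithin_const_smul_apply ((hf z hzm).of_le hn) hU hzm, hf' n z hz, smul_zero]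

/-- `C_c^∞(𝔻^{int})`: smooth functions with compact support in the open unit disk. -/
def smoothCompact : Submodule ℂ (ℂ → ℂ) where
  carrier := {f | ContDiff ℝ ∞ f ∧ HasCompactSupport f ∧ tsupport f ⊆ ball 0 1}
  zero_mem' := ⟨contDiff_const, HasCompactSupport.zero, by simp [tsupport]⟩
  add_mem' := by
    rintro f g ⟨hf, hf', hf''⟩ ⟨hg, hg', hg''⟩
    exact ⟨hf.add hg, hf'.add hg', (tsupport_add f g).trans (Set.union_subset hf'' hg'')⟩
  smul_mem' := by
    rintro c f ⟨hf, hf', hf''⟩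
    exact ⟨hf.const_smul c, hf'.smul_left (f := fun _ => c),
      (closure_mono (Function.support_const_smul_subset c f)).trans hf''⟩

theorem smoothFlat_le : smoothFlat ≤ smoothInterior :=
  fun _ hf => hf.1.mono ball_subset_closedBall

theorem smoothCompact_le : smoothCompact ≤ smoothInterior :=
  fun _ hf => hf.1.contDiffOn

/-! ### Realizations of `L_γ` in `L²_γ` -/

theorem contDiffAt_of_mem {f : ℂ → ℂ} (hf : f ∈ smoothInterior) {z : ℂ} (hz : z ∈ ball (0 : ℂ) 1) :
    ContDiffAt ℝ ∞ f z :=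
  ContDiffOn.contDiffAt hf (isOpen_ball.mem_nhds hz)

/-- The graph, in `L²_γ × L²_γ`, of `L_γ` with domain a given space `P` of smooth functions: all
pairs of classes `([f], [L_γ f])` with `f ∈ P`. -/
def opGraph (γ : ℝ) (P : Submodule ℂ (ℂ → ℂ)) (hP : P ≤ smoothInterior) :
    Submodule ℂ (DiskL2 γ × DiskL2 γ) where
  carrier := {p | ∃ f ∈ P, p.1 =ᵐ[diskMeasure γ] f ∧ p.2 =ᵐ[diskMeasure γ] diskOp γ f}
  zero_mem' := by
    refine ⟨0, P.zero_mem, Lp.coeFn_zero _ _ _, ?_⟩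
    have h : diskOp γ 0 = 0 := funext fun z => diskOp_eq_zero γ EventuallyEq.rfl
    rw [h]
    exact Lp.coeFn_zero _ _ _
  add_mem' := by
    rintro p q ⟨f, hf, hf1, hf2⟩ ⟨g, hg, hg1, hg2⟩
    refine ⟨f + g, P.add_mem hf hg, (Lp.coeFn_add _ _).trans (hf1.add hg1), ?_⟩
    refine (Lp.coeFn_add _ _).trans ((hf2.add hg2).trans ?_)
    refine (ae_diskMeasure_iff γ _).2 ?_
    filter_upwards [ae_restrict_mem measurableSet_ball] with z hz
    exact (diskOp_add γ (contDiffAt_of_mem (hP hf) hz) (contDiffAt_of_mem (hP hg) hz)).symm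
  smul_mem' := by
    rintro c p ⟨f, hf, hf1, hf2⟩
    refine ⟨c • f, P.smul_mem c hf, (Lp.coeFn_smul _ _).trans (hf1.const_smul c), ?_⟩
    refine (Lp.coeFn_smul _ _).trans ((hf2.const_smul c).trans ?_)
    refine (ae_diskMeasure_iff γ _).2 ?_
    filter_upwards [ae_restrict_mem measurableSet_ball] with z hz
    exact (diskOp_smul γ c (contDiffAt_of_mem (hP hf) hz)).symm

/-- `opGraph` is the graph of a (single-valued) operator: a smooth function that vanishes almost
everywhere in the disk is annihilated by `L_γ`. -/
theorem opGraph_singleValued (γ : ℝ) (P : Submodule ℂ (ℂ → ℂ)) (hP : P ≤ smoothInterior) :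
    ∀ p ∈ opGraph γ P hP, p.1 = 0 → p.2 = 0 := by
  rintro ⟨u, v⟩ ⟨f, hf, hf1, hf2⟩ hu
  dsimp only at hf1 hf2 hu ⊢
  subst hu
  have h0 : f =ᵐ[diskMeasure γ] 0 := hf1.symm.trans (Lp.coeFn_zero _ _ _)
  have h1 : f =ᵐ[volume.restrict (ball (0 : ℂ) 1)] 0 := (ae_diskMeasure_iff γ _).1 h0
  have h2 : Set.EqOn f 0 (ball 0 1) :=
    Measure.eqOn_open_of_ae_eq h1 isOpen_ball (ContDiffOn.continuousOn (hP hf)) continuousOn_const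
  refine Lp.ext (hf2.trans (EventuallyEq.trans ?_ (Lp.coeFn_zero _ _ _).symm))
  refine (ae_diskMeasure_iff γ _).2 ?_
  filter_upwards [ae_restrict_mem measurableSet_ball] with z hz
  exact diskOp_eq_zero γ (h2.eventuallyEq_of_mem (isOpen_ball.mem_nhds hz))

/-- The unbounded operator `(L_γ, P)` in `L²_γ`: it sends the class of `f ∈ P` to the class
of `L_γ f`. -/
def opOn (γ : ℝ) (P : Submodule ℂ (ℂ → ℂ)) (hP : P ≤ smoothInterior) :
    DiskL2 γ →ₗ.[ℂ] DiskL2 γ :=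
  (opGraph γ P hP).toLinearPMap

theorem opOn_graph (γ : ℝ) (P : Submodule ℂ (ℂ → ℂ)) (hP : P ≤ smoothInterior) :
    (opOn γ P hP).graph = opGraph γ P hP :=
  Submodule.toLinearPMap_graph_eq _ (opGraph_singleValued γ P hP)

/-- The preminimal operator `(L_γ, Ċ^∞(𝔻))`. -/
def preminimal (γ : ℝ) : DiskL2 γ →ₗ.[ℂ] DiskL2 γ := opOn γ smoothFlat smoothFlat_le

/-- The minimal operator `L_{γ,min}`: the closure of the preminimal operator. -/
def minimal (γ : ℝ) : DiskL2 γ →ₗ.[ℂ] DiskL2 γ := (preminimal γ).closure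

/-- The operator `(L_γ, C_c^∞(𝔻^{int}))`. -/
def compactOp (γ : ℝ) : DiskL2 γ →ₗ.[ℂ] DiskL2 γ := opOn γ smoothCompact smoothCompact_le

/-! ### The Friedrichs extension -/

section Friedrichs

variable {H : Type*} [NormedAddCommGroup H] [InnerProductSpace ℂ H]

/-- The sesquilinear form `α(u, v) = (T u, v)` of an operator `T`, linear in `u`
(Mathlib's inner product is linear in its second argument). -/
def form (T : H →ₗ.[ℂ] H) (u v : T.domain) : ℂ := inner ℂ (v : H) (T u)

/-- The sequence `u n` in the domain of `T` `α`-converges to `x`: it converges to `x` in the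
Hilbert space and `α(u n - u m, u n - u m) → 0` as `m, n → ∞`. -/
def FormTendsto (T : H →ₗ.[ℂ] H) (u : ℕ → T.domain) (x : H) : Prop :=
  Tendsto (fun n => (u n : H)) atTop (𝓝 x) ∧
    Tendsto (fun p : ℕ × ℕ => form T (u p.1 - u p.2) (u p.1 - u p.2)) atTop (𝓝 0)

/-- The form domain `V`: the `α`-closure of the domain of `T`. -/
def formDomain (T : H →ₗ.[ℂ] H) : Set H := {x | ∃ u, FormTendsto T u x}

/-- `α̃(x, y) = c` for the extension by continuity `α̃` of the form `α` to the form domain. -/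
def HasFormValue (T : H →ₗ.[ℂ] H) (x y : H) (c : ℂ) : Prop :=
  x ∈ formDomain T ∧ y ∈ formDomain T ∧
    ∀ u v : ℕ → T.domain, FormTendsto T u x → FormTendsto T v y →
      Tendsto (fun n => form T (u n) (v n)) atTop (𝓝 c)

/-- `S` is the Friedrichs extension of the densely defined, symmetric, nonnegative operator `T`:
`x ∈ dom S` and `S x = w` hold exactly when `x` lies in the form domain `V` and
`α̃(x, y) = (w, y)` for all `y ∈ V`. -/
structure IsFriedrichsExtension (T S : H →ₗ.[ℂ] H) : Prop where
  dense : Dense (T.domain : Set H)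
  symmetric : T.IsFormalAdjoint T
  nonneg : ∀ u : T.domain, 0 ≤ (form T u u).re
  mem_graph_iff : ∀ x w : H, (x, w) ∈ S.graph ↔
    x ∈ formDomain T ∧ ∀ y ∈ formDomain T, HasFormValue T x y (inner ℂ y w)

end Friedrichs

end DiskOperator

end

open scoped ComplexConjugate Manifold

/-!
For a symmetric nonnegative operator `T` such that `1 + T` has dense range, `T† = T.closure`; hence
the closure of `T` is self-adjoint, it is the Friedrichs extension of `T`, and every symmetric
extension of `T` has the same closure. So everything rests on the density of `(1 + L_γ) C_c^∞`.

Suppose `v ⟂ (1 + L_γ) C_c^∞` and `γ ≥ 1`. For a cutoff `χ` vanishing near the boundary and equal to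
`1` on `{x > 2 / n}`, the commutator `[L_γ, χ]` is `O(n)` and lives in a collar of measure
`O(n⁻²)`, so it drops out in the limit and `v ⟂ (1 + L_γ) g` for every `g` smooth up to the
boundary. Now `L_γ (z^a z̄^b) = (a + b + γ + 1)² z^a z̄^b - 4ab z^(a-1) z̄^(b-1)`, and induction on
`a` shows that `v` is orthogonal to all monomials, so `v = 0` by the Stone–Weierstrass theorem. The
case `γ ≤ -1` reduces to `-γ` because `L_γ x^{-γ} = x^{-γ} L_{-γ}`.
-/

namespace DiskOperator

section SelfAdjoint

variable {H : Type*} [NormedAddCommGroup H] [InnerProductSpace ℂ H] {S T : H →ₗ.[ℂ] H}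

theorem norm_le_norm_add_apply (hn : ∀ u : T.domain, 0 ≤ (inner ℂ (u : H) (T u)).re)
    (u : T.domain) : ‖(u : H)‖ ≤ ‖(u : H) + T u‖ := by
  have h : ‖(u : H)‖ ^ 2 ≤ ‖(u : H)‖ * ‖(u : H) + T u‖ :=
    calc ‖(u : H)‖ ^ 2 ≤ ‖(u : H)‖ ^ 2 + (inner ℂ (u : H) (T u)).re :=
          le_add_of_nonneg_right (hn u)
      _ = RCLike.re (inner ℂ (u : H) ((u : H) + T u)) := by
          rw [inner_add_right, map_add, inner_self_eq_norm_sq]; rfl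
      _ ≤ ‖(u : H)‖ * ‖(u : H) + T u‖ := re_inner_le_norm _ _
  rcases (norm_nonneg (u : H)).eq_or_lt with h0 | h0
  · exact h0 ▸ norm_nonneg _
  · exact le_of_mul_le_mul_left (by rwa [← sq]) h0

theorem denseRange_add_apply [CompleteSpace H]
    (h : ∀ v : H, (∀ u : T.domain, inner ℂ ((u : H) + T u) v = 0) → v = 0) :
    DenseRange fun u : T.domain => (u : H) + T u := by
  have hr : (LinearMap.range (T.domain.subtype + T.toFun)).topologicalClosure = ⊤ := by
    rw [Submodule.topologicalClosure_eq_top_iff, Submodule.eq_bot_iff]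
    exact fun v hv => h v fun u => (Submodule.mem_orthogonal _ _).1 hv _ ⟨u, rfl⟩
  exact Submodule.dense_iff_topologicalClosure_eq_top.2 hr

theorem closure_le_of_isClosed (hS : S.IsClosed) (h : T ≤ S) : T.closure ≤ S := by
  refine LinearPMap.le_of_le_graph ?_
  rw [← (hS.isClosable.leIsClosable h).graph_closure_eq_closure_graph]
  exact Submodule.topologicalClosure_minimal _ (LinearPMap.le_graph_of_le h) hS

variable [CompleteSpace H]

theorem mem_graph_adjoint_iff (hd : Dense (T.domain : Set H)) {x w : H} :
    (x, w) ∈ T.adjoint.graph ↔ ∀ u : T.domain, inner ℂ (T u) x = inner ℂ (u : H) w := by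
  rw [LinearPMap.adjoint_graph_eq_graph_adjoint hd, Submodule.mem_adjoint_iff]
  refine ⟨fun h u => sub_eq_zero.1 (h _ _ (T.mem_graph u)), fun h a b hab => ?_⟩
  obtain ⟨u, rfl, rfl⟩ := T.mem_graph_iff.1 hab
  exact sub_eq_zero.2 (h u)

theorem adjoint_antitone (hd : Dense (T.domain : Set H)) (h : T ≤ S) : S.adjoint ≤ T.adjoint := by
  refine LinearPMap.le_of_le_graph fun p hp => (mem_graph_adjoint_iff hd).2 fun u => ?_
  have hu := (mem_graph_adjoint_iff (hd.mono h.1)).1 hp ⟨u, h.1 u.2⟩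
  rwa [← h.2 (x := u) (y := ⟨u, h.1 u.2⟩) rfl] at hu

theorem isClosable_of_isFormalAdjoint (hd : Dense (T.domain : Set H)) (hs : T.IsFormalAdjoint S) :
    S.IsClosable :=
  (LinearPMap.adjoint_isClosed hd).isClosable.leIsClosable (hs.le_adjoint hd)

theorem adjoint_closure (hd : Dense (T.domain : Set H)) (hc : T.IsClosable) :
    T.closure.adjoint = T.adjoint := by
  refine le_antisymm (adjoint_antitone hd T.le_closure) (LinearPMap.le_of_le_graph ?_)
  rintro ⟨x, w⟩ hxw
  refine (mem_graph_adjoint_iff (hd.mono T.le_closure.1)).2 fun u => ?_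
  have hcl : IsClosed {p : H × H | inner ℂ p.2 x = inner ℂ p.1 w} :=
    isClosed_eq (by fun_prop) (by fun_prop)
  have hT : (T.graph : Set (H × H)) ⊆ {p : H × H | inner ℂ p.2 x = inner ℂ p.1 w} := by
    intro p hp
    obtain ⟨a, ha, hTa⟩ := T.mem_graph_iff.1 hp
    simpa only [Set.mem_ofPred_eq, ← ha, ← hTa] using (mem_graph_adjoint_iff hd).1 hxw a
  have hu : ((u : H), T.closure u) ∈ T.graph.topologicalClosure := by
    rw [hc.graph_closure_eq_closure_graph]
    exact T.closure.mem_graph u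
  exact closure_minimal hT hcl hu

theorem exists_mem_closure_graph (hn : ∀ u : T.domain, 0 ≤ (inner ℂ (u : H) (T u)).re)
    (hr : DenseRange fun u : T.domain => (u : H) + T u) (y : H) :
    ∃ x, (x, y - x) ∈ T.graph.topologicalClosure := by
  obtain ⟨f, hf, hlim⟩ := mem_closure_iff_seq_limit.1 (hr y)
  choose u hu using hf
  have hdist : ∀ n m, dist (u n : H) (u m : H) ≤ dist (f n) (f m) := fun n m => by
    have h := norm_le_norm_add_apply hn (u n - u m)
    rw [LinearPMap.map_sub, AddSubgroupClass.coe_sub, ← add_sub_add_comm] at h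
    rwa [dist_eq_norm, dist_eq_norm, ← hu n, ← hu m]
  have hcauchy : CauchySeq fun n => (u n : H) := by
    rw [Metric.cauchySeq_iff]
    intro ε hε
    obtain ⟨N, hN⟩ := Metric.cauchySeq_iff.1 hlim.cauchySeq ε hε
    exact ⟨N, fun m hm n hn => (hdist m n).trans_lt (hN m hm n hn)⟩
  obtain ⟨x, hx⟩ := cauchySeq_tendsto_of_complete hcauchy
  have hTx : Tendsto (fun n => T (u n)) atTop (𝓝 (y - x)) :=
    (hlim.sub hx).congr fun n => by rw [← hu n, add_sub_cancel_left]
  exact ⟨x, mem_closure_of_tendsto (hx.prodMk_nhds hTx)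
    (Eventually.of_forall fun n => T.mem_graph (u n))⟩

theorem adjoint_eq_closure (hd : Dense (T.domain : Set H)) (hs : T.IsFormalAdjoint T)
    (hn : ∀ u : T.domain, 0 ≤ (inner ℂ (u : H) (T u)).re)
    (hr : DenseRange fun u : T.domain => (u : H) + T u) : T.adjoint = T.closure := by
  have hle : T.closure ≤ T.adjoint :=
    closure_le_of_isClosed (LinearPMap.adjoint_isClosed hd) (hs.le_adjoint hd)
  refine le_antisymm (LinearPMap.le_of_le_graph ?_) hle
  rintro ⟨v, w⟩ hvw
  obtain ⟨x, hx⟩ := exists_mem_closure_graph hn hr (v + w)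
  rw [(isClosable_of_isFormalAdjoint hd hs).graph_closure_eq_closure_graph] at hx
  have hdiff : (v - x, -(v - x)) ∈ T.adjoint.graph := by
    have heq : (v - x, -(v - x)) = (v, w) - (x, v + w - x) :=
      Prod.ext rfl (show -(v - x) = w - (v + w - x) by abel)
    exact heq ▸ T.adjoint.graph.sub_mem hvw (LinearPMap.le_graph_of_le hle hx)
  have horth : ∀ u : T.domain, inner ℂ ((u : H) + T u) (v - x) = 0 := fun u => by
    rw [inner_add_left, (mem_graph_adjoint_iff hd).1 hdiff u, inner_neg_right, add_neg_cancel]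
  have hvx : v - x = 0 := inner_self_eq_zero.1 <| congr_fun
    (hr.equalizer (by fun_prop) continuous_const (funext horth) :
      (fun y => inner ℂ y (v - x)) = fun _ => (0 : ℂ)) (v - x)
  rwa [← sub_eq_zero.1 hvx, add_sub_cancel_left] at hx

theorem isSelfAdjoint_closure (hd : Dense (T.domain : Set H)) (h : T.adjoint = T.closure) :
    IsSelfAdjoint T.closure := by
  have hcl : T.closure.IsClosed := h ▸ LinearPMap.adjoint_isClosed hd
  exact (adjoint_closure hd (hcl.isClosable.leIsClosable T.le_closure)).trans h

theorem eq_of_isSelfAdjoint_of_le (hT : IsSelfAdjoint T) (hS : IsSelfAdjoint S) (h : T ≤ S) :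
    S = T := by
  refine le_antisymm ?_ h
  have hST := adjoint_antitone hT.dense_domain h
  rwa [LinearPMap.isSelfAdjoint_def.1 hT, LinearPMap.isSelfAdjoint_def.1 hS] at hST

theorem closure_eq_of_isFormalAdjoint (hd : Dense (T.domain : Set H))
    (h : T.adjoint = T.closure) (hTS : T ≤ S) (hs : T.IsFormalAdjoint S) :
    S.closure = T.closure := by
  have hS : S ≤ T.closure := h ▸ hs.le_adjoint hd
  have hcl : T.closure.IsClosed := h ▸ LinearPMap.adjoint_isClosed hd
  exact le_antisymm (closure_le_of_isClosed hcl hS)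
    ((hcl.isClosable.leIsClosable hS).closure_mono hTS)

end SelfAdjoint

section Form

variable {H : Type*} [NormedAddCommGroup H] [InnerProductSpace ℂ H] {T : H →ₗ.[ℂ] H}

theorem form_sub_left (u v w : T.domain) : form T (u - v) w = form T u w - form T v w := by
  simp [form, LinearPMap.map_sub]

theorem form_sub_right (u v w : T.domain) : form T u (v - w) = form T u v - form T u w := by
  simp [form]

theorem form_add_left (u v w : T.domain) : form T (u + v) w = form T u w + form T v w := by
  simp [form, LinearPMap.map_add]

theorem form_add_right (u v w : T.domain) : form T u (v + w) = form T u v + form T u w := by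
  simp [form]

theorem form_conj (hs : T.IsFormalAdjoint T) (u v : T.domain) :
    conj (form T u v) = form T v u := by
  rw [form, form, inner_conj_symm]
  exact hs u v

theorem ofReal_re_form_self (hs : T.IsFormalAdjoint T) (u : T.domain) :
    ((form T u u).re : ℂ) = form T u u :=
  Complex.conj_eq_iff_re.1 (form_conj hs u u)

theorem re_form_parallelogram (u v : T.domain) :
    (form T (u + v) (u + v)).re + (form T (u - v) (u - v)).re =
      2 * ((form T u u).re + (form T v v).re) := by
  simp only [form_sub_left, form_sub_right, form_add_left, form_add_right, Complex.add_re,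
    Complex.sub_re]
  ring

theorem norm_form_sq_le (hs : T.IsFormalAdjoint T) (hn : ∀ u : T.domain, 0 ≤ (form T u u).re)
    (u v : T.domain) : ‖form T u v‖ ^ 2 ≤ (form T u u).re * (form T v v).re := by
  let core : PreInnerProductSpace.Core ℂ T.domain :=
    { inner := fun u v => form T v u
      conj_inner_symm := fun u v => form_conj hs u v
      re_inner_nonneg := hn
      add_left := fun u v w => form_add_right _ _ _
      smul_left := fun u v r => by simp [form, mul_comm] }
  have h : ‖form T u v‖ * ‖form T v u‖ ≤ (form T v v).re * (form T u u).re :=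
    InnerProductSpace.Core.inner_mul_inner_self_le (c := core) v u
  rwa [← form_conj hs u v, RCLike.norm_conj, ← sq, mul_comm] at h

theorem formTendsto_const (u : T.domain) : FormTendsto T (fun _ => u) (u : H) :=
  ⟨tendsto_const_nhds, by simp [form]⟩

theorem formTendsto_of_graph_tendsto {u : ℕ → T.domain} {x w : H}
    (hu : Tendsto (fun n => (u n : H)) atTop (𝓝 x))
    (hw : Tendsto (fun n => T (u n)) atTop (𝓝 w)) : FormTendsto T u x := by
  refine ⟨hu, ?_⟩
  have hdiff : ∀ {a : ℕ → H} {b : H}, Tendsto a atTop (𝓝 b) →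
      Tendsto (fun p : ℕ × ℕ => a p.1 - a p.2) atTop (𝓝 0) := fun {a b} ha => by
    rw [← prod_atTop_atTop_eq, ← sub_self b]
    exact (ha.comp tendsto_fst).sub (ha.comp tendsto_snd)
  simpa [form, LinearPMap.map_sub, inner_sub_left, inner_sub_right] using
    (hdiff hu).inner (𝕜 := ℂ) (hdiff hw)

theorem FormTendsto.exists_forall_re_lt {u : ℕ → T.domain} {x : H} (hu : FormTendsto T u x)
    {ε : ℝ} (hε : 0 < ε) :
    ∃ N, ∀ n ≥ N, ∀ m ≥ N, (form T (u n - u m) (u n - u m)).re < ε := by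
  have h := (Complex.continuous_re.tendsto 0).comp hu.2
  exact eventually_atTop_prod_self'.1 (h.eventually (gt_mem_nhds hε))

theorem FormTendsto.sub (hs : T.IsFormalAdjoint T) (hn : ∀ u : T.domain, 0 ≤ (form T u u).re)
    {u v : ℕ → T.domain} {x y : H} (hu : FormTendsto T u x) (hv : FormTendsto T v y) :
    FormTendsto T (fun n => u n - v n) (x - y) := by
  refine ⟨hu.1.sub hv.1, squeeze_zero_norm (fun p => ?_)
    (by simpa using (hu.2.norm.add hv.2.norm).const_mul 2)⟩
  have hnorm : ∀ a : T.domain, ‖form T a a‖ = (form T a a).re := fun a => by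
    rw [← ofReal_re_form_self hs a, Complex.norm_of_nonneg (hn a), Complex.ofReal_re]
  rw [sub_sub_sub_comm, hnorm, hnorm, hnorm, ← re_form_parallelogram]
  exact le_add_of_nonneg_left (hn _)

theorem FormTendsto.exists_bound (hn : ∀ u : T.domain, 0 ≤ (form T u u).re)
    {u : ℕ → T.domain} {x : H} (hu : FormTendsto T u x) :
    ∃ C, ∀ᶠ n in atTop, (form T (u n) (u n)).re ≤ C := by
  obtain ⟨N, hN⟩ := hu.exists_forall_re_lt one_pos
  refine ⟨2 * (1 + (form T (u N) (u N)).re), eventually_atTop.2 ⟨N, fun n hnN => ?_⟩⟩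
  have h := re_form_parallelogram (u n - u N) (u N)
  rw [sub_add_cancel] at h
  linarith [hN n hnN N le_rfl, hn (u n - u N - u N)]

theorem FormTendsto.tendsto_re_form_zero (hs : T.IsFormalAdjoint T)
    (hn : ∀ u : T.domain, 0 ≤ (form T u u).re) {a : ℕ → T.domain} (ha : FormTendsto T a 0) :
    Tendsto (fun n => (form T (a n) (a n)).re) atTop (𝓝 0) := by
  refine Metric.tendsto_atTop.2 fun ε hε => ?_
  obtain ⟨N, hN⟩ := ha.exists_forall_re_lt (half_pos hε)
  refine ⟨N, fun n hnN => ?_⟩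
  have hlim : Tendsto (fun m => ε / 2 + 2 * (form T (a n) (a m)).re) atTop (𝓝 (ε / 2)) := by
    have h : Tendsto (fun m => form T (a n) (a m)) atTop (𝓝 0) := by
      simpa [form] using ha.1.inner (tendsto_const_nhds (x := T (a n)))
    simpa using (((Complex.continuous_re.tendsto 0).comp h).const_mul 2).const_add (ε / 2)
  have hle : (form T (a n) (a n)).re ≤ ε / 2 := by
    refine ge_of_tendsto hlim (eventually_atTop.2 ⟨N, fun m hmN => ?_⟩)
    have h := hN n hnN m hmN
    have hsymm : (form T (a m) (a n)).re = (form T (a n) (a m)).re := by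
      rw [← form_conj hs, Complex.conj_re]
    simp only [form_sub_left, form_sub_right, Complex.sub_re] at h
    linarith [hn (a m)]
  rw [Real.dist_eq, sub_zero, abs_of_nonneg (hn _)]
  linarith

theorem tendsto_form_of_graph_tendsto (hs : T.IsFormalAdjoint T)
    (hn : ∀ u : T.domain, 0 ≤ (form T u u).re) {a u v : ℕ → T.domain} {x y w : H}
    (ha : Tendsto (fun n => (a n : H)) atTop (𝓝 x)) (hTa : Tendsto (fun n => T (a n)) atTop (𝓝 w))
    (hu : FormTendsto T u x) (hv : FormTendsto T v y) :
    Tendsto (fun n => form T (u n) (v n)) atTop (𝓝 (inner ℂ y w)) := by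
  have hmain : Tendsto (fun n => form T (a n) (v n)) atTop (𝓝 (inner ℂ y w)) := hv.1.inner hTa
  have hua : Tendsto (fun n => (form T (u n - a n) (u n - a n)).re) atTop (𝓝 0) := by
    refine FormTendsto.tendsto_re_form_zero hs hn ?_
    simpa using hu.sub hs hn (formTendsto_of_graph_tendsto ha hTa)
  obtain ⟨C, hC⟩ := hv.exists_bound hn
  have hrest : Tendsto (fun n => form T (u n - a n) (v n)) atTop (𝓝 0) := by
    refine squeeze_zero_norm' ?_ (by simpa using (hua.mul_const C).sqrt)
    filter_upwards [hC] with n hCn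
    exact Real.le_sqrt_of_sq_le ((norm_form_sq_le hs hn _ _).trans
      (mul_le_mul_of_nonneg_left hCn (hn _)))
  simpa [form_sub_left] using hrest.add hmain

theorem exists_seq_of_mem_closure_graph {x w : H} (h : (x, w) ∈ T.graph.topologicalClosure) :
    ∃ a : ℕ → T.domain, Tendsto (fun n => (a n : H)) atTop (𝓝 x) ∧
      Tendsto (fun n => T (a n)) atTop (𝓝 w) := by
  obtain ⟨p, hp, hlim⟩ := mem_closure_iff_seq_limit.1 h
  choose a ha hTa using fun n => T.mem_graph_iff.1 (hp n)
  exact ⟨a, by simpa only [ha] using hlim.fst_nhds, by simpa only [hTa] using hlim.snd_nhds⟩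

theorem isFriedrichsExtension_closure [CompleteSpace H] (hd : Dense (T.domain : Set H))
    (hs : T.IsFormalAdjoint T) (hn : ∀ u : T.domain, 0 ≤ (form T u u).re)
    (h : T.adjoint = T.closure) : IsFriedrichsExtension T T.closure := by
  refine ⟨hd, hs, hn, fun x w => ⟨fun hxw => ?_, fun ⟨⟨u, hu⟩, hval⟩ => ?_⟩⟩
  · rw [← (isClosable_of_isFormalAdjoint hd hs).graph_closure_eq_closure_graph] at hxw
    obtain ⟨a, ha, hTa⟩ := exists_seq_of_mem_closure_graph hxw
    have hx : x ∈ formDomain T := ⟨a, formTendsto_of_graph_tendsto ha hTa⟩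
    exact ⟨hx, fun y hy => ⟨hx, hy, fun _ _ hu hv =>
      tendsto_form_of_graph_tendsto hs hn ha hTa hu hv⟩⟩
  · rw [← h, mem_graph_adjoint_iff hd]
    intro φ
    have hφ := (hval φ ⟨_, formTendsto_const φ⟩).2.2 u _ hu (formTendsto_const φ)
    have hlim : Tendsto (fun n => form T (u n) φ) atTop (𝓝 (inner ℂ (T φ) x)) :=
      (tendsto_const_nhds.inner hu.1).congr fun n => hs φ (u n)
    exact tendsto_nhds_unique hlim hφ

end Form

section Calculus

theorem differentiableAt_fderiv {E F : Type*} [NormedAddCommGroup E] [NormedSpace ℝ E]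
    [NormedAddCommGroup F] [NormedSpace ℝ F] {f : E → F} {x : E} (hf : ContDiffAt ℝ 2 f x) :
    DifferentiableAt ℝ (fderiv ℝ f) x :=
  (hf.fderiv_right (m := 1) (by norm_num)).differentiableAt one_ne_zero

theorem fderiv_fderiv_mul_apply {E 𝔸 : Type*} [NormedAddCommGroup E] [NormedSpace ℝ E]
    [NormedField 𝔸] [NormedAlgebra ℝ 𝔸] {f g : E → 𝔸} {x : E} (hf : ContDiffAt ℝ 2 f x)
    (hg : ContDiffAt ℝ 2 g x) (v w : E) :
    fderiv ℝ (fderiv ℝ fun y => f y * g y) x v w =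
      f x * fderiv ℝ (fderiv ℝ g) x v w + fderiv ℝ f x v * fderiv ℝ g x w +
        (g x * fderiv ℝ (fderiv ℝ f) x v w + fderiv ℝ g x v * fderiv ℝ f x w) := by
  have hnear : fderiv ℝ (fun y => f y * g y) =ᶠ[𝓝 x]
      fun y => f y • fderiv ℝ g y + g y • fderiv ℝ f y := by
    filter_upwards [hf.eventually (by simp), hg.eventually (by simp)] with y hfy hgy
    exact fderiv_fun_mul (hfy.differentiableAt two_ne_zero) (hgy.differentiableAt two_ne_zero)
  have hf1 := hf.differentiableAt two_ne_zero
  have hg1 := hg.differentiableAt two_ne_zero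
  have hf2 := differentiableAt_fderiv hf
  have hg2 := differentiableAt_fderiv hg
  rw [hnear.fderiv_eq, fderiv_fun_add (hf1.fun_smul hg2) (hg1.fun_smul hf2),
    fderiv_fun_smul hf1 hg2, fderiv_fun_smul hg1 hf2]
  simp

variable {γ : ℝ} {f g : ℂ → ℂ} {z : ℂ}

theorem fderiv_angular_apply (hf : ContDiffAt ℝ 2 f z) (v : ℂ) :
    fderiv ℝ (angular f) z v =
      fderiv ℝ (fderiv ℝ f) z v (Complex.I * z) + fderiv ℝ f z (Complex.I * v) := by
  have h : HasFDerivAt (angular f) _ z :=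
    (differentiableAt_fderiv hf).hasFDerivAt.clm_apply
      (ContinuousLinearMap.mul ℝ ℂ Complex.I).hasFDerivAt
  rw [h.fderiv]
  simp [add_comm]

theorem diskOp_eq (hf : ContDiffAt ℝ 2 f z) :
    diskOp γ f z = -(bdf z : ℂ) * (fderiv ℝ (fderiv ℝ f) z 1 1 +
        fderiv ℝ (fderiv ℝ f) z Complex.I Complex.I)
      + ((2 + 2 * γ : ℝ) : ℂ) * fderiv ℝ f z z
      - (fderiv ℝ (fderiv ℝ f) z (Complex.I * z) (Complex.I * z) - fderiv ℝ f z z)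
      + (((γ + 1) ^ 2 : ℝ) : ℂ) * f z := by
  have h : Complex.I * (Complex.I * z) = -z := by rw [← mul_assoc, Complex.I_mul_I, neg_one_mul]
  rw [diskOp, radial, angular, fderiv_angular_apply hf, h, map_neg,
    InnerProductSpace.laplacian_eq_iteratedFDeriv_complexPlane]
  simp only [iteratedFDeriv_two_apply, Matrix.cons_val_zero, Matrix.cons_val_one]
  ring

/-- The carré du champ of `L_γ`, the `ℂ`-bilinear form `x ∇f · ∇g + ∂_ω f ∂_ω g`. It measures the
failure of the Leibniz rule for `L_γ`, and it is the integrand of the Dirichlet form. -/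
noncomputable def carreDuChamp (f g : ℂ → ℂ) (z : ℂ) : ℂ :=
  bdf z * (fderiv ℝ f z 1 * fderiv ℝ g z 1 + fderiv ℝ f z Complex.I * fderiv ℝ g z Complex.I) +
    angular f z * angular g z

theorem diskOp_mul (hf : ContDiffAt ℝ 2 f z) (hg : ContDiffAt ℝ 2 g z) :
    diskOp γ (fun y => f y * g y) z = f z * diskOp γ g z + g z * diskOp γ f z
      - (((γ + 1) ^ 2 : ℝ) : ℂ) * (f z * g z) - 2 * carreDuChamp f g z := by
  rw [diskOp_eq (hf.mul hg), diskOp_eq hf, diskOp_eq hg,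
    fderiv_fun_mul (hf.differentiableAt two_ne_zero) (hg.differentiableAt two_ne_zero)]
  simp only [fderiv_fderiv_mul_apply hf hg, carreDuChamp, angular, add_apply, smul_apply,
    smul_eq_mul]
  ring

theorem fderiv_conj_apply (hf : DifferentiableAt ℝ f z) (v : ℂ) :
    fderiv ℝ (fun y => conj (f y)) z v = conj (fderiv ℝ f z v) := by
  have h : fderiv ℝ (fun y => conj (f y)) z = _ :=
    (Complex.conjCLE.toContinuousLinearMap.hasFDerivAt.comp z hf.hasFDerivAt).fderiv
  rw [h]
  simp

theorem diskOp_conj (hf : ContDiffAt ℝ 2 f z) :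
    diskOp γ (fun y => conj (f y)) z = conj (diskOp γ f z) := by
  have hnear : angular (fun y => conj (f y)) =ᶠ[𝓝 z] fun y => conj (angular f y) := by
    filter_upwards [hf.eventually (by simp)] with y hy
    exact fderiv_conj_apply (hy.differentiableAt two_ne_zero) _
  have hang : DifferentiableAt ℝ (angular f) z :=
    (differentiableAt_fderiv hf).clm_apply (by fun_prop)
  have hang2 : angular (angular fun y => conj (f y)) z = conj (angular (angular f) z) := by
    rw [angular, hnear.fderiv_eq, fderiv_conj_apply hang, angular]
  have hlap : Laplacian.laplacian (fun y => conj (f y)) z = conj (Laplacian.laplacian f z) :=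
    hf.laplacian_CLM_comp_left (l := Complex.conjCLE.toContinuousLinearMap)
  rw [diskOp, diskOp, hang2, hlap, radial,
    fderiv_conj_apply (hf.differentiableAt two_ne_zero), radial]
  simp only [map_add, map_sub, map_mul, map_neg, Complex.conj_ofReal]

theorem fderiv_pow_apply (a : ℕ) (z v : ℂ) :
    fderiv ℝ (fun y => y ^ a) z v = a * z ^ (a - 1) * v := by
  rw [(hasDerivAt_pow a z).complexToReal_fderiv.fderiv]
  simp

theorem natCast_mul_pow_pred_mul (a : ℕ) (z : ℂ) : a * z ^ (a - 1) * z = a * z ^ a := by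
  cases a with
  | zero => simp
  | succ n => rw [Nat.add_sub_cancel, mul_assoc, ← pow_succ]

theorem angular_pow (a : ℕ) : angular (fun y => y ^ a) = (Complex.I * a) • fun y => y ^ a := by
  funext y
  rw [angular, fderiv_pow_apply, mul_left_comm, natCast_mul_pow_pred_mul, Pi.smul_apply,
    smul_eq_mul, mul_assoc]

theorem diskOp_pow (a : ℕ) (z : ℂ) :
    diskOp γ (fun y => y ^ a) z = (((a + γ + 1) ^ 2 : ℝ) : ℂ) * z ^ a := by
  have hrad : radial (fun y => y ^ a) z = a * z ^ a := by
    rw [radial, fderiv_pow_apply, natCast_mul_pow_pred_mul]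
  have hang : angular (angular fun y => y ^ a) z = -(a : ℂ) ^ 2 * z ^ a := by
    have h : angular ((Complex.I * a) • fun y => y ^ a) z =
        Complex.I * a * angular (fun y => y ^ a) z := by
      rw [angular, fderiv_const_smul (by fun_prop), smul_apply, smul_eq_mul, angular]
    rw [angular_pow, h, angular_pow, Pi.smul_apply, smul_eq_mul]
    linear_combination (a ^ 2 * z ^ a : ℂ) * Complex.I_mul_I
  have hlap : Laplacian.laplacian (fun y : ℂ => y ^ a) z = 0 :=
    (AnalyticAt.harmonicAt (by fun_prop)).2.eq_of_nhds
  rw [diskOp, hlap, hrad, hang]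
  push_cast
  ring

theorem ofReal_bdf (z : ℂ) : (bdf z : ℂ) = 1 - z * conj z := by
  rw [bdf, Complex.mul_conj, Complex.normSq_eq_norm_sq, Complex.ofReal_sub, Complex.ofReal_one]

theorem carreDuChamp_pow_conj_pow (a b : ℕ) (z : ℂ) :
    carreDuChamp (fun y => y ^ a) (fun y => conj (y ^ b)) z =
      2 * a * b * (z ^ (a - 1) * conj z ^ (b - 1)) - a * b * (z ^ a * conj z ^ b) := by
  have hconj : ∀ v, fderiv ℝ (fun y => conj (y ^ b)) z v = b * conj z ^ (b - 1) * conj v :=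
    fun v => by
      rw [fderiv_conj_apply (by fun_prop), fderiv_pow_apply]
      simp
  simp only [carreDuChamp, angular, fderiv_pow_apply, hconj, ofReal_bdf, map_mul, map_one,
    Complex.conj_I]
  have ha := natCast_mul_pow_pred_mul a z
  have hb := natCast_mul_pow_pred_mul b (conj z)
  linear_combination (-a * b * (z ^ (a - 1) * conj z ^ (b - 1)) : ℂ) * Complex.I_mul_I -
    (b * conj z ^ (b - 1) * conj z) * ha - (a * z ^ a) * hb

theorem diskOp_pow_mul_conj_pow (a b : ℕ) (z : ℂ) :
    diskOp γ (fun y => y ^ a * conj (y ^ b)) z =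
      (((a + b + γ + 1) ^ 2 : ℝ) : ℂ) * (z ^ a * conj (z ^ b)) -
        4 * a * b * (z ^ (a - 1) * conj (z ^ (b - 1))) := by
  have hb : ContDiff ℝ 2 fun y : ℂ => conj (y ^ b) := Complex.conjCLE.contDiff.comp (by fun_prop)
  rw [diskOp_mul (by fun_prop) hb.contDiffAt, diskOp_conj (by fun_prop), diskOp_pow, diskOp_pow,
    carreDuChamp_pow_conj_pow]
  simp only [map_mul, map_pow, Complex.conj_ofReal]
  push_cast
  ring

theorem bdf_eq (z : ℂ) : bdf z = 1 - (z.re ^ 2 + z.im ^ 2) := by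
  rw [bdf, Complex.sq_norm, Complex.normSq_apply, sq, sq]

theorem contDiff_bdf {n : WithTop ℕ∞} : ContDiff ℝ n bdf :=
  contDiff_const.sub (contDiff_norm_sq ℝ)

theorem fderiv_comp_bdf_apply {h : ℝ → ℝ} (hh : DifferentiableAt ℝ h (bdf z)) (v : ℂ) :
    fderiv ℝ (fun y => (h (bdf y) : ℂ)) z v = ((-2 * deriv h (bdf z) * inner ℝ z v : ℝ) : ℂ) := by
  have hbdf : HasFDerivAt bdf (-(2 : ℝ) • innerSL ℝ z) z :=
    ((hasStrictFDerivAt_norm_sq z).hasFDerivAt.const_sub 1).congr_fderiv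
      (by rw [neg_smul, two_smul, two_smul])
  have hcomp : HasFDerivAt (fun y => (h (bdf y) : ℂ)) _ z :=
    Complex.ofRealCLM.hasFDerivAt.comp z (hh.hasDerivAt.hasFDerivAt.comp z hbdf)
  rw [hcomp.fderiv]
  simp only [ContinuousLinearMap.comp_apply, ContinuousLinearMap.toSpanSingleton_apply, smul_apply,
    innerSL_apply_apply, smul_eq_mul, Complex.ofRealCLM_apply]
  push_cast
  ring

theorem contDiffAt_comp_bdf {h : ℝ → ℝ} {n : WithTop ℕ∞} (hh : ContDiffAt ℝ n h (bdf z)) :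
    ContDiffAt ℝ n (fun y => (h (bdf y) : ℂ)) z :=
  Complex.ofRealCLM.contDiff.contDiffAt.comp z (hh.comp z contDiff_bdf.contDiffAt)

theorem fderiv_fderiv_comp_bdf_apply {h : ℝ → ℝ} (hh : ContDiffAt ℝ 2 h (bdf z)) (v w : ℂ) :
    fderiv ℝ (fderiv ℝ fun y => (h (bdf y) : ℂ)) z v w =
      ((4 * deriv (deriv h) (bdf z) * (inner ℝ z v * inner ℝ z w) -
        2 * deriv h (bdf z) * inner ℝ v w : ℝ) : ℂ) := by
  have hnear : (fun y => fderiv ℝ (fun y => (h (bdf y) : ℂ)) y w) =ᶠ[𝓝 z]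
      fun y => ((deriv h (bdf y) : ℝ) : ℂ) * ((-2 * inner ℝ w y : ℝ) : ℂ) := by
    filter_upwards [(contDiff_bdf (n := 0)).continuous.continuousAt.eventually
      (hh.eventually (by simp))] with y hy
    rw [fderiv_comp_bdf_apply (hy.differentiableAt two_ne_zero), real_inner_comm,
      ← Complex.ofReal_mul]
    ring_nf
  have hh' : DifferentiableAt ℝ (deriv h) (bdf z) :=
    (differentiableAt_fderiv hh).clm_apply (differentiableAt_const 1)
  have hinner : HasFDerivAt (fun y : ℂ => ((-2 * inner ℝ w y : ℝ) : ℂ)) _ z :=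
    Complex.ofRealCLM.hasFDerivAt.comp z ((innerSL ℝ w).hasFDerivAt.const_mul (-2))
  have hbdf' : DifferentiableAt ℝ (fun y => ((deriv h (bdf y) : ℝ) : ℂ)) z :=
    Complex.ofRealCLM.differentiableAt.comp z
      (hh'.comp z (contDiff_bdf.differentiable one_ne_zero z))
  have happly : fderiv ℝ (fun y => fderiv ℝ (fun y => (h (bdf y) : ℂ)) y w) z v =
      fderiv ℝ (fderiv ℝ fun y => (h (bdf y) : ℂ)) z v w := by
    rw [fderiv_clm_apply (differentiableAt_fderiv (contDiffAt_comp_bdf hh))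
      (differentiableAt_const w)]
    simp
  rw [← happly, hnear.fderiv_eq, fderiv_fun_mul hbdf' hinner.differentiableAt, add_apply,
    smul_apply, smul_apply, fderiv_comp_bdf_apply hh', hinner.fderiv]
  simp only [ContinuousLinearMap.comp_apply, smul_apply, innerSL_apply_apply, smul_eq_mul,
    Complex.ofRealCLM_apply, real_inner_comm w]
  push_cast
  ring

theorem diskOp_comp_bdf {h : ℝ → ℝ} (hh : ContDiffAt ℝ 2 h (bdf z)) :
    diskOp γ (fun y => (h (bdf y) : ℂ)) z =
      ((-4 * bdf z * (1 - bdf z) * deriv (deriv h) (bdf z) + 4 * bdf z * deriv h (bdf z)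
        - 4 * (1 + γ) * (1 - bdf z) * deriv h (bdf z) + (γ + 1) ^ 2 * h (bdf z) : ℝ) : ℂ) := by
  rw [diskOp_eq (contDiffAt_comp_bdf hh)]
  simp only [fderiv_fderiv_comp_bdf_apply hh,
    fderiv_comp_bdf_apply (hh.differentiableAt two_ne_zero)]
  simp only [bdf_eq, Complex.inner]
  simp only [Complex.ofReal_sub, Complex.ofReal_one, Complex.ofReal_add, Complex.ofReal_pow,
    neg_sub, one_mul, Complex.conj_re, map_one, mul_one, Complex.one_re, Complex.ofReal_mul,
    Complex.ofReal_ofNat, Complex.mul_re, Complex.I_re, zero_mul, Complex.I_im, Complex.conj_im,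
    mul_neg, sub_neg_eq_add, zero_add, Complex.conj_I, Complex.I_mul_I, neg_neg, neg_mul,
    Complex.ofReal_neg, zero_sub, Complex.mul_im, map_mul, Complex.neg_re, neg_zero,
    sub_add_cancel, sub_sub_cancel, add_left_inj]
  ring

theorem clm_apply_eq (ℓ : ℂ →L[ℝ] ℂ) (v : ℂ) : ℓ v = v.re * ℓ 1 + v.im * ℓ Complex.I := by
  have hv : v = v.re • (1 : ℂ) + v.im • Complex.I := by simp [Complex.re_add_im]
  nth_rw 1 [hv]
  rw [map_add, map_smul, map_smul, Complex.real_smul, Complex.real_smul]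

theorem carreDuChamp_comp_bdf {h : ℝ → ℝ} (hh : DifferentiableAt ℝ h (bdf z)) :
    carreDuChamp (fun y => (h (bdf y) : ℂ)) g z =
      ((-2 * bdf z * deriv h (bdf z) : ℝ) : ℂ) * radial g z := by
  rw [radial, clm_apply_eq _ z, carreDuChamp, angular]
  simp only [fderiv_comp_bdf_apply hh, Complex.inner, neg_mul, one_mul, Complex.conj_re,
    Complex.ofReal_neg, Complex.ofReal_mul, Complex.ofReal_ofNat, Complex.mul_re, Complex.I_re,
    zero_mul, Complex.I_im, Complex.conj_im, mul_neg, sub_neg_eq_add, zero_add, zero_sub,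
    Complex.mul_im, Complex.ofReal_add]
  ring

theorem diskOp_comp_bdf_mul {h : ℝ → ℝ} (hh : ContDiffAt ℝ 2 h (bdf z)) (hg : ContDiffAt ℝ 2 g z) :
    diskOp γ (fun y => (h (bdf y) : ℂ) * g y) z = (h (bdf z) : ℂ) * diskOp γ g z
      + ((-4 * bdf z * (1 - bdf z) * deriv (deriv h) (bdf z) + 4 * bdf z * deriv h (bdf z)
        - 4 * (1 + γ) * (1 - bdf z) * deriv h (bdf z) : ℝ) : ℂ) * g z
      + ((4 * bdf z * deriv h (bdf z) : ℝ) : ℂ) * radial g z := by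
  rw [diskOp_mul (contDiffAt_comp_bdf hh) hg, diskOp_comp_bdf hh,
    carreDuChamp_comp_bdf (hh.differentiableAt two_ne_zero)]
  push_cast
  ring

theorem diskOp_rpow_mul (hz : bdf z ≠ 0) (hg : ContDiffAt ℝ 2 g z) :
    diskOp γ (fun y => ((bdf y ^ (-γ) : ℝ) : ℂ) * g y) z =
      ((bdf z ^ (-γ) : ℝ) : ℂ) * diskOp (-γ) g z := by
  have hderiv : deriv (fun t : ℝ => t ^ (-γ)) = fun t => -γ * t ^ (-γ - 1) :=
    Real.deriv_rpow_const' _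
  have hderiv2 : deriv (fun t : ℝ => -γ * t ^ (-γ - 1)) =
      fun t => -γ * ((-γ - 1) * t ^ (-γ - 1 - 1)) := by
    funext t
    rw [deriv_const_mul_field, Real.deriv_rpow_const]
  rw [diskOp_comp_bdf_mul (h := fun t => t ^ (-γ)) (Real.contDiffAt_rpow_const_of_ne hz) hg,
    hderiv, hderiv2, diskOp, diskOp]
  simp only [Real.rpow_sub_one hz]
  have hne : (bdf z : ℂ) ≠ 0 := by exact_mod_cast hz
  push_cast
  field_simp
  ring

theorem bdf_pos (hz : z ∈ ball 0 1) : 0 < bdf z := by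
  rw [mem_ball_zero_iff] at hz
  rw [bdf, sub_pos, sq_lt_one_iff₀ (norm_nonneg z)]
  exact hz

end Calculus

section Measure

theorem measurable_density (γ : ℝ) : Measurable fun z : ℂ => ENNReal.ofReal (bdf z ^ γ) := by
  unfold bdf
  fun_prop

theorem ae_mem_ball (γ : ℝ) : ∀ᵐ z ∂diskMeasure γ, z ∈ ball (0 : ℂ) 1 :=
  (ae_diskMeasure_iff γ _).2 (ae_restrict_mem measurableSet_ball)

theorem toReal_density {γ : ℝ} {z : ℂ} (hz : z ∈ ball (0 : ℂ) 1) :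
    (ENNReal.ofReal (bdf z ^ γ)).toReal = bdf z ^ γ :=
  ENNReal.toReal_ofReal (Real.rpow_nonneg (bdf_pos hz).le _)

theorem integral_diskMeasure {E : Type*} [NormedAddCommGroup E] [NormedSpace ℝ E]
    (γ : ℝ) (h : ℂ → E) :
    ∫ z, h z ∂diskMeasure γ = ∫ z in ball (0 : ℂ) 1, bdf z ^ γ • h z := by
  rw [diskMeasure, integral_withDensity_eq_integral_toReal_smul (measurable_density γ)
    (Eventually.of_forall fun _ => ENNReal.ofReal_lt_top)]
  exact setIntegral_congr_fun measurableSet_ball fun z hz => by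
    simp only [toReal_density hz]

theorem integrable_diskMeasure_iff {E : Type*} [NormedAddCommGroup E] [NormedSpace ℝ E]
    (γ : ℝ) (h : ℂ → E) :
    Integrable h (diskMeasure γ) ↔ IntegrableOn (fun z => bdf z ^ γ • h z) (ball 0 1) := by
  rw [diskMeasure, integrable_withDensity_iff_integrable_smul' (measurable_density γ)
    (Eventually.of_forall fun _ => ENNReal.ofReal_lt_top)]
  exact integrableOn_congr_fun (fun z hz => by simp only [toReal_density hz]) measurableSet_ball

theorem aestronglyMeasurable_diskMeasure {γ : ℝ} {h : ℂ → ℂ} (hc : ContinuousOn h (ball 0 1)) :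
    AEStronglyMeasurable h (diskMeasure γ) :=
  (hc.aestronglyMeasurable measurableSet_ball).mono_ac (withDensity_absolutelyContinuous _ _)

theorem rpow_bdf_mem_smoothInterior (γ : ℝ) :
    (fun y => ((bdf y ^ γ : ℝ) : ℂ)) ∈ smoothInterior := fun _ hz =>
  (contDiffAt_comp_bdf (h := fun t => t ^ γ)
    (Real.contDiffAt_rpow_const_of_ne (bdf_pos hz).ne')).contDiffWithinAt

variable {γ : ℝ} {g h : ℂ → ℂ}

theorem hasCompactSupport_of_support_subset (hg : g ∈ smoothCompact)
    (hs : Function.support h ⊆ tsupport g) : HasCompactSupport h ∧ tsupport h ⊆ ball 0 1 :=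
  ⟨hg.2.1.mono' hs, (closure_minimal hs (isClosed_tsupport g)).trans hg.2.2⟩

theorem integrable_of_support_subset (hg : g ∈ smoothCompact) (hc : ContinuousOn h (ball 0 1))
    (hs : Function.support h ⊆ tsupport g) : Integrable h (diskMeasure γ) := by
  rw [integrable_diskMeasure_iff]
  have hweight : ContinuousOn (fun z => bdf z ^ γ • h z) (ball 0 1) :=
    (rpow_bdf_mem_smoothInterior γ).continuousOn.mul hc
  obtain ⟨hcpt, hball⟩ := hasCompactSupport_of_support_subset hg
    ((Function.support_smul_subset_right (fun z => bdf z ^ γ) h).trans hs)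
  have hcont : Continuous fun z => bdf z ^ γ • h z := continuous_of_tsupport fun z hz =>
    hweight.continuousAt (isOpen_ball.mem_nhds (hball hz))
  exact (hcont.integrable_of_hasCompactSupport hcpt).integrableOn

theorem memLp_of_support_subset (hg : g ∈ smoothCompact) (hc : ContinuousOn h (ball 0 1))
    (hs : Function.support h ⊆ tsupport g) : MemLp h 2 (diskMeasure γ) := by
  rw [memLp_two_iff_integrable_sq_norm (aestronglyMeasurable_diskMeasure hc)]
  have hmul : Integrable (fun z => h z * h z) (diskMeasure γ) :=
    integrable_of_support_subset hg (hc.mul hc)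
      ((Function.support_mul_subset_left h h).trans hs)
  exact hmul.norm.congr (Eventually.of_forall fun z => by simp only [norm_mul, sq])

end Measure

section Smooth

variable {γ : ℝ} {f g : ℂ → ℂ}

theorem contDiffOn_fderiv (hf : f ∈ smoothInterior) : ContDiffOn ℝ ∞ (fderiv ℝ f) (ball 0 1) :=
  ContDiffOn.fderiv_of_isOpen hf isOpen_ball (by norm_cast)

theorem continuousOn_diskOp (hf : f ∈ smoothInterior) :
    ContinuousOn (diskOp γ f) (ball 0 1) := by
  have hcont : ContinuousOn f (ball 0 1) := ContDiffOn.continuousOn hf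
  have hcont1 := (contDiffOn_fderiv hf).continuousOn
  have hcont2 : ContinuousOn (fderiv ℝ (fderiv ℝ f)) (ball 0 1) :=
    (contDiffOn_fderiv hf).continuousOn_fderiv_of_isOpen isOpen_ball (by simp)
  have hbdf : Continuous bdf := (contDiff_bdf (n := 0)).continuous
  refine ContinuousOn.congr ?_ fun z hz =>
    diskOp_eq ((contDiffAt_of_mem hf hz).of_le (by norm_cast))
  fun_prop

theorem continuousOn_carreDuChamp (hf : f ∈ smoothInterior) (hg : g ∈ smoothInterior) :
    ContinuousOn (carreDuChamp f g) (ball 0 1) := by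
  have hcontf := (contDiffOn_fderiv hf).continuousOn
  have hcontg := (contDiffOn_fderiv hg).continuousOn
  have hbdf : Continuous bdf := (contDiff_bdf (n := 0)).continuous
  unfold carreDuChamp angular
  fun_prop

theorem support_diskOp_subset (γ : ℝ) (f : ℂ → ℂ) : Function.support (diskOp γ f) ⊆ tsupport f :=
  fun _ hz => by_contra fun h => hz (diskOp_eq_zero γ (notMem_tsupport_iff_eventuallyEq.1 h))

theorem mem_smoothCompact_of_support_subset (hf : f ∈ smoothInterior) (hg : g ∈ smoothCompact)
    (hs : Function.support f ⊆ tsupport g) : f ∈ smoothCompact := by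
  obtain ⟨hcpt, hball⟩ := hasCompactSupport_of_support_subset hg hs
  have hsmooth : ContMDiff 𝓘(ℝ, ℂ) 𝓘(ℝ, ℂ) ∞ f := contMDiff_of_tsupport fun z hz =>
    (contDiffAt_of_mem hf (hball hz)).contMDiffAt
  exact ⟨hsmooth.contDiff, hcpt, hball⟩

theorem mul_mem_smoothInterior (hf : f ∈ smoothInterior) (hg : g ∈ smoothInterior) :
    (fun z => f z * g z) ∈ smoothInterior :=
  ContDiffOn.mul hf hg

theorem mul_mem_smoothCompact (hf : f ∈ smoothInterior) (hg : g ∈ smoothCompact) :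
    (fun z => f z * g z) ∈ smoothCompact :=
  mem_smoothCompact_of_support_subset (mul_mem_smoothInterior hf (smoothCompact_le hg)) hg
    ((Function.support_mul_subset_right f g).trans (subset_tsupport g))

theorem conj_mem_smoothCompact (hg : g ∈ smoothCompact) : (fun z => conj (g z)) ∈ smoothCompact :=
  ⟨Complex.conjCLE.contDiff.comp hg.1, hasCompactSupport_of_support_subset hg fun _ hz =>
    subset_tsupport g fun h0 => hz (by simp only [h0, map_zero])⟩

theorem memLp_smoothCompact (hf : f ∈ smoothCompact) : MemLp f 2 (diskMeasure γ) :=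
  memLp_of_support_subset hf hf.1.continuous.continuousOn (subset_tsupport f)

theorem memLp_diskOp_smoothCompact (hf : f ∈ smoothCompact) :
    MemLp (diskOp γ f) 2 (diskMeasure γ) :=
  memLp_of_support_subset hf (continuousOn_diskOp (smoothCompact_le hf)) (support_diskOp_subset γ f)

end Smooth

section Green

theorem integral_fderiv_eq_zero {E F : Type*} [NormedAddCommGroup E] [NormedSpace ℝ E]
    [MeasurableSpace E] [BorelSpace E] [FiniteDimensional ℝ E] {μ : Measure E} [μ.IsAddHaarMeasure]
    [NormedAddCommGroup F] [NormedSpace ℝ F] {f : E → F} (hf : ContDiff ℝ 1 f)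
    (hs : HasCompactSupport f) (v : E) : ∫ x, fderiv ℝ f x v ∂μ = 0 := by
  have hint : Integrable (fun x => fderiv ℝ f x v) μ :=
    ((hf.continuous_fderiv one_ne_zero).clm_apply
      continuous_const).integrable_of_hasCompactSupport (hs.fderiv_apply ℝ v)
  have hparts := integral_smul_fderiv_eq_neg_fderiv_smul_of_integrable (𝕜 := ℝ) (μ := μ)
    (f := fun _ => (1 : ℝ)) (g := f) (v := v) (by simp) (by simpa using hint)
    (by simpa using hf.continuous.integrable_of_hasCompactSupport hs)
    (fun _ _ => differentiableAt_const _) (fun x _ => hf.differentiable one_ne_zero x)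
  simpa using hparts

variable {γ : ℝ} {f g : ℂ → ℂ} {z : ℂ}

theorem carreDuChamp_comm (f g : ℂ → ℂ) (z : ℂ) : carreDuChamp f g z = carreDuChamp g f z := by
  rw [carreDuChamp, carreDuChamp]
  ring

theorem carreDuChamp_mul {h : ℂ → ℂ} (hg : DifferentiableAt ℝ g z) (hh : DifferentiableAt ℝ h z) :
    carreDuChamp f (fun y => g y * h y) z =
      g z * carreDuChamp f h z + h z * carreDuChamp f g z := by
  simp only [carreDuChamp, angular, fderiv_fun_mul hg hh, add_apply, smul_apply, smul_eq_mul]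
  ring

/-- The component in the direction `w` of the vector field `x ∇f + ∂_ω f · i z`, whose pairing
with `∇h` is `carreDuChamp f h` and whose divergence is the leading part of `-L_γ f`. -/
noncomputable def flux (f : ℂ → ℂ) (w z : ℂ) : ℂ :=
  bdf z * fderiv ℝ f z w + (inner ℝ (Complex.I * z) w : ℝ) * angular f z

theorem flux_mul_add_flux_mul (f g : ℂ → ℂ) (z : ℂ) :
    flux f 1 z * fderiv ℝ g z 1 + flux f Complex.I z * fderiv ℝ g z Complex.I =
      carreDuChamp f g z := by
  rw [carreDuChamp, flux, flux, angular, angular, clm_apply_eq (fderiv ℝ g z) (Complex.I * z)]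
  simp only [Complex.inner, map_mul, Complex.conj_I, neg_mul, mul_neg, one_mul, Complex.neg_re,
    Complex.mul_re, Complex.I_re, Complex.conj_re, zero_mul, Complex.I_im, Complex.conj_im,
    sub_neg_eq_add, zero_add, Complex.ofReal_neg, Complex.mul_im, neg_zero, zero_sub, neg_neg]
  ring

theorem flux_mem_smoothInterior (hf : f ∈ smoothInterior) (w : ℂ) : flux f w ∈ smoothInterior := by
  have hbdf : ContDiff ℝ ∞ fun z => (bdf z : ℂ) := Complex.ofRealCLM.contDiff.comp contDiff_bdf
  have hinner : ContDiff ℝ ∞ fun z : ℂ => ((inner ℝ (Complex.I * z) w : ℝ) : ℂ) :=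
    Complex.ofRealCLM.contDiff.comp ((contDiff_const.mul contDiff_id).inner ℝ contDiff_const)
  have hangular : ContDiffOn ℝ ∞ (angular f) (ball 0 1) :=
    (contDiffOn_fderiv hf).clm_apply (contDiff_const.mul contDiff_id).contDiffOn
  exact (hbdf.contDiffOn.mul ((contDiffOn_fderiv hf).clm_apply contDiffOn_const)).add
    (hinner.contDiffOn.mul hangular)

theorem support_flux_subset (f : ℂ → ℂ) (w : ℂ) : Function.support (flux f w) ⊆ tsupport f :=
  fun z hz => by_contra fun h => hz <| by
    simp [flux, angular, (notMem_tsupport_iff_eventuallyEq.1 h).fderiv_eq]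

theorem fderiv_flux_apply (hf : ContDiffAt ℝ 2 f z) (w v : ℂ) :
    fderiv ℝ (flux f w) z v = bdf z * fderiv ℝ (fderiv ℝ f) z v w
      - 2 * (inner ℝ z v : ℝ) * fderiv ℝ f z w + (inner ℝ (Complex.I * z) w : ℝ) *
        fderiv ℝ (angular f) z v + (inner ℝ (Complex.I * v) w : ℝ) * angular f z := by
  have hbdf : fderiv ℝ (fun y => (bdf y : ℂ)) z v = -2 * (inner ℝ z v : ℝ) := by
    have h := fderiv_comp_bdf_apply (h := id) (z := z) differentiableAt_id v
    simpa only [id_eq, deriv_id, mul_one, Complex.ofReal_mul, Complex.ofReal_neg,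
      Complex.ofReal_ofNat] using h
  have hinner : HasFDerivAt (fun y : ℂ => ((inner ℝ w (Complex.I * y) : ℝ) : ℂ)) _ z :=
    (Complex.ofRealCLM ∘L innerSL ℝ w ∘L ContinuousLinearMap.mul ℝ ℂ Complex.I).hasFDerivAt
  have hfw : HasFDerivAt (fun y => fderiv ℝ f y w) _ z :=
    (differentiableAt_fderiv hf).hasFDerivAt.clm_apply (hasFDerivAt_const w z)
  have hangular : DifferentiableAt ℝ (angular f) z :=
    (differentiableAt_fderiv hf).clm_apply (by fun_prop)
  have hbdf' : DifferentiableAt ℝ (fun y => (bdf y : ℂ)) z :=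
    (contDiffAt_comp_bdf (h := id) (n := 1) contDiffAt_id).differentiableAt one_ne_zero
  have hflux : flux f w = fun y => bdf y * fderiv ℝ f y w +
      (inner ℝ w (Complex.I * y) : ℝ) * angular f y :=
    funext fun y => by rw [flux, real_inner_comm]
  rw [hflux, fderiv_fun_add (hbdf'.fun_mul hfw.differentiableAt)
    (hinner.differentiableAt.fun_mul hangular), fderiv_fun_mul hbdf' hfw.differentiableAt,
    fderiv_fun_mul hinner.differentiableAt hangular, hinner.fderiv, hfw.fderiv]
  simp only [add_apply, smul_apply, smul_eq_mul, hbdf, ContinuousLinearMap.comp_apply,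
    ContinuousLinearMap.flip_apply, zero_apply, map_zero,
    innerSL_apply_apply, ContinuousLinearMap.mul_apply', Complex.ofRealCLM_apply,
    real_inner_comm w]
  ring

theorem fderiv_flux_add_fderiv_flux (hf : ContDiffAt ℝ 2 f z) :
    fderiv ℝ (flux f 1) z 1 + fderiv ℝ (flux f Complex.I) z Complex.I =
      2 * γ * radial f z + (γ + 1) ^ 2 * f z - diskOp γ f z := by
  have hangular := clm_apply_eq (fderiv ℝ (angular f) z) (Complex.I * z)
  rw [fderiv_flux_apply hf, fderiv_flux_apply hf, diskOp_eq hf, radial,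
    clm_apply_eq (fderiv ℝ f z) z]
  rw [fderiv_angular_apply hf (Complex.I * z), ← mul_assoc Complex.I Complex.I z,
    Complex.I_mul_I, neg_one_mul, map_neg, clm_apply_eq (fderiv ℝ f z) z] at hangular
  simp only [Complex.inner, map_mul, Complex.conj_I]
  simp only [neg_add_rev, Complex.mul_re, Complex.I_re, zero_mul, Complex.I_im, one_mul, zero_sub,
    Complex.ofReal_neg, neg_mul, Complex.mul_im, zero_add, Complex.conj_re, mul_neg, Complex.neg_re,
    Complex.conj_im, sub_neg_eq_add, map_one, mul_one, neg_zero, Complex.ofReal_zero, add_zero,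
    neg_neg, Complex.I_mul_I, Complex.ofReal_add, Complex.ofReal_ofNat, Complex.ofReal_mul,
    Complex.ofReal_pow, Complex.ofReal_one, add_sub_add_right_eq_sub] at hangular ⊢
  linear_combination -hangular

theorem fderiv_flux_mul_add_fderiv_flux_mul (hf : f ∈ smoothInterior) (hg : g ∈ smoothInterior)
    (hz : z ∈ ball 0 1) :
    fderiv ℝ (fun y => flux f 1 y * (((bdf y ^ γ : ℝ) : ℂ) * g y)) z 1 +
        fderiv ℝ (fun y => flux f Complex.I y * (((bdf y ^ γ : ℝ) : ℂ) * g y)) z Complex.I =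
      bdf z ^ γ • (carreDuChamp f g z + (γ + 1) ^ 2 * (f z * g z) - diskOp γ f z * g z) := by
  have hdiff : ∀ {F : ℂ → ℂ}, F ∈ smoothInterior → DifferentiableAt ℝ F z := fun hF =>
    (contDiffAt_of_mem hF hz).differentiableAt (by simp)
  have hweight := hdiff (rpow_bdf_mem_smoothInterior γ)
  have hne := (bdf_pos hz).ne'
  have hcarre : carreDuChamp f (fun y => ((bdf y ^ γ : ℝ) : ℂ)) z =
      -2 * γ * ((bdf z ^ γ : ℝ) : ℂ) * radial f z := by
    rw [carreDuChamp_comm, carreDuChamp_comp_bdf (h := fun t => t ^ γ)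
      (Real.differentiableAt_rpow_const_of_ne γ hne), Real.deriv_rpow_const, Real.rpow_sub_one hne]
    have hne' : (bdf z : ℂ) ≠ 0 := by exact_mod_cast hne
    push_cast
    field_simp
  have hdiv := fderiv_flux_add_fderiv_flux (γ := γ) ((contDiffAt_of_mem hf hz).of_le (by norm_cast))
  have hpair := flux_mul_add_flux_mul f (fun y => ((bdf y ^ γ : ℝ) : ℂ) * g y) z
  rw [carreDuChamp_mul hweight (hdiff hg), hcarre] at hpair
  rw [fderiv_fun_mul (hdiff (flux_mem_smoothInterior hf _)) (hweight.fun_mul (hdiff hg)),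
    fderiv_fun_mul (hdiff (flux_mem_smoothInterior hf _)) (hweight.fun_mul (hdiff hg))]
  simp only [add_apply, smul_apply, smul_eq_mul, Complex.real_smul]
  linear_combination hpair + ((bdf z ^ γ : ℝ) : ℂ) * g z * hdiv

theorem integral_ball_fderiv_eq_zero (hf : f ∈ smoothCompact) (v : ℂ) :
    ∫ z in ball (0 : ℂ) 1, fderiv ℝ f z v = 0 := by
  rw [setIntegral_eq_integral_of_forall_compl_eq_zero fun z hz => ?_]
  · exact integral_fderiv_eq_zero (hf.1.of_le (by norm_cast)) hf.2.1 v
  · rw [(notMem_tsupport_iff_eventuallyEq.1 fun h => hz (hf.2.2 h)).fderiv_eq]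
    simp

theorem integral_carreDuChamp_sub_diskOp_mul (hf : f ∈ smoothInterior) (hg : g ∈ smoothInterior)
    (hflux : ∀ w, (fun z => flux f w z * (((bdf z ^ γ : ℝ) : ℂ) * g z)) ∈ smoothCompact) :
    ∫ z, (carreDuChamp f g z + (γ + 1) ^ 2 * (f z * g z) - diskOp γ f z * g z) ∂diskMeasure γ =
      0 := by
  have hint : ∀ w v, IntegrableOn
      (fderiv ℝ (fun z => flux f w z * (((bdf z ^ γ : ℝ) : ℂ) * g z)) · v) (ball 0 1) := fun w v =>
    (((hflux w).1.continuous_fderiv (by simp)).clm_apply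
      continuous_const).integrable_of_hasCompactSupport ((hflux w).2.1.fderiv_apply ℝ v)
      |>.integrableOn
  rw [integral_diskMeasure, setIntegral_congr_fun measurableSet_ball fun z hz =>
    (fderiv_flux_mul_add_fderiv_flux_mul hf hg hz).symm, integral_add (hint _ _) (hint _ _),
    integral_ball_fderiv_eq_zero (hflux 1), integral_ball_fderiv_eq_zero (hflux _), add_zero]

theorem integrable_dirichlet (hf : f ∈ smoothInterior) (hg : g ∈ smoothCompact) :
    Integrable (fun z => carreDuChamp f g z + (γ + 1) ^ 2 * (f z * g z)) (diskMeasure γ) := by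
  have hcf : ContinuousOn f (ball 0 1) := ContDiffOn.continuousOn hf
  have hcg := hg.1.continuous.continuousOn (s := ball 0 1)
  refine integrable_of_support_subset hg ((continuousOn_carreDuChamp hf (smoothCompact_le hg)).add
    (continuousOn_const.mul (hcf.mul hcg))) fun z hz => by_contra fun h => hz ?_
  have h0 := notMem_tsupport_iff_eventuallyEq.1 h
  simp [carreDuChamp, angular, h0.fderiv_eq, h0.eq_of_nhds]

theorem integral_diskOp_mul (hf : f ∈ smoothInterior) (hg : g ∈ smoothCompact) :
    ∫ z, diskOp γ f z * g z ∂diskMeasure γ =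
      ∫ z, (carreDuChamp f g z + (γ + 1) ^ 2 * (f z * g z)) ∂diskMeasure γ := by
  have hint : Integrable (fun z => diskOp γ f z * g z) (diskMeasure γ) :=
    integrable_of_support_subset hg ((continuousOn_diskOp hf).mul hg.1.continuous.continuousOn)
      ((Function.support_mul_subset_right _ g).trans (subset_tsupport g))
  have h := integral_carreDuChamp_sub_diskOp_mul (γ := γ) hf (smoothCompact_le hg) fun w =>
    mul_mem_smoothCompact (flux_mem_smoothInterior hf w)
      (mul_mem_smoothCompact (rpow_bdf_mem_smoothInterior γ) hg)
  rw [integral_sub (integrable_dirichlet hf hg) hint, sub_eq_zero] at h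
  exact h.symm

theorem integral_mul_diskOp (hf : f ∈ smoothInterior) (hg : g ∈ smoothCompact) :
    ∫ z, f z * diskOp γ g z ∂diskMeasure γ =
      ∫ z, (carreDuChamp f g z + (γ + 1) ^ 2 * (f z * g z)) ∂diskMeasure γ := by
  have hint : Integrable (fun z => f z * diskOp γ g z) (diskMeasure γ) :=
    integrable_of_support_subset hg (ContinuousOn.mul (ContDiffOn.continuousOn hf)
      (continuousOn_diskOp (smoothCompact_le hg)))
      ((Function.support_mul_subset_right f _).trans (support_diskOp_subset γ g))
  have hflux : ∀ w, (fun z => flux g w z * (((bdf z ^ γ : ℝ) : ℂ) * f z)) ∈ smoothCompact :=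
    fun w => mem_smoothCompact_of_support_subset (mul_mem_smoothInterior
      (flux_mem_smoothInterior (smoothCompact_le hg) w)
      (mul_mem_smoothInterior (rpow_bdf_mem_smoothInterior γ) hf)) hg
      ((Function.support_mul_subset_left _ _).trans (support_flux_subset g w))
  have h := integral_carreDuChamp_sub_diskOp_mul (γ := γ) (smoothCompact_le hg) hf hflux
  simp only [carreDuChamp_comm g f, mul_comm (g _) (f _), mul_comm (diskOp γ g _) (f _)] at h
  rw [integral_sub (integrable_dirichlet hf hg) hint, sub_eq_zero] at h
  exact h.symm

/-- No boundary term appears, as one of the two functions has compact support in the open disk. -/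
theorem integral_diskOp_mul_conj_comm (hf : f ∈ smoothInterior) (hg : g ∈ smoothCompact) :
    ∫ z, diskOp γ f z * conj (g z) ∂diskMeasure γ =
      ∫ z, f z * conj (diskOp γ g z) ∂diskMeasure γ := by
  rw [integral_diskOp_mul hf (conj_mem_smoothCompact hg),
    ← integral_mul_diskOp hf (conj_mem_smoothCompact hg)]
  simp only [diskOp_conj (hg.1.contDiffAt.of_le (by norm_cast))]

theorem re_carreDuChamp_conj_nonneg (hg : DifferentiableAt ℝ g z) (hz : z ∈ ball 0 1) :
    0 ≤ (carreDuChamp g (fun y => conj (g y)) z).re := by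
  have hsq : carreDuChamp g (fun y => conj (g y)) z = ((bdf z * (‖fderiv ℝ g z 1‖ ^ 2 +
      ‖fderiv ℝ g z Complex.I‖ ^ 2) + ‖fderiv ℝ g z (Complex.I * z)‖ ^ 2 : ℝ) : ℂ) := by
    simp only [carreDuChamp, angular, fderiv_conj_apply hg, Complex.mul_conj,
      Complex.normSq_eq_norm_sq]
    push_cast
    rfl
  have hx := (bdf_pos hz).le
  rw [hsq, Complex.ofReal_re]
  positivity

theorem re_integral_diskOp_mul_conj_nonneg (hg : g ∈ smoothCompact) :
    0 ≤ (∫ z, diskOp γ g z * conj (g z) ∂diskMeasure γ).re := by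
  rw [integral_diskOp_mul (smoothCompact_le hg) (conj_mem_smoothCompact hg),
    ← RCLike.re_eq_complex_re,
    ← integral_re (integrable_dirichlet (smoothCompact_le hg) (conj_mem_smoothCompact hg))]
  refine integral_nonneg_of_ae ?_
  filter_upwards [ae_mem_ball γ] with z hz
  have hsq : (γ + 1 : ℂ) ^ 2 * (g z * conj (g z)) = (((γ + 1) ^ 2 * ‖g z‖ ^ 2 : ℝ) : ℂ) := by
    rw [Complex.mul_conj, Complex.normSq_eq_norm_sq]
    push_cast
    rfl
  rw [hsq, map_add, RCLike.re_eq_complex_re, Complex.ofReal_re]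
  exact add_nonneg (re_carreDuChamp_conj_nonneg (hg.1.differentiable (by simp) z) hz)
    (by positivity)

end Green

section Realization

variable {γ : ℝ} {P : Submodule ℂ (ℂ → ℂ)} {hP : P ≤ smoothInterior}

theorem exists_ae_eq_of_mem_domain (u : (opOn γ P hP).domain) :
    ∃ f ∈ P, (u : DiskL2 γ) =ᵐ[diskMeasure γ] f ∧ opOn γ P hP u =ᵐ[diskMeasure γ] diskOp γ f := by
  have hu := (opOn γ P hP).mem_graph u
  rwa [opOn_graph] at hu

theorem toLp_mem_graph_opOn {f : ℂ → ℂ} (hf : f ∈ P) (h : MemLp f 2 (diskMeasure γ))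
    (hL : MemLp (diskOp γ f) 2 (diskMeasure γ)) :
    (h.toLp f, hL.toLp (diskOp γ f)) ∈ (opOn γ P hP).graph := by
  rw [opOn_graph]
  exact ⟨f, hf, h.coeFn_toLp, hL.coeFn_toLp⟩

theorem inner_eq_integral {α : Type*} [MeasurableSpace α] {μ : Measure α} {u v : Lp ℂ 2 μ}
    {f g : α → ℂ} (hu : u =ᵐ[μ] f) (hv : v =ᵐ[μ] g) :
    inner ℂ u v = ∫ x, g x * conj (f x) ∂μ := by
  rw [L2.inner_def]
  refine integral_congr_ae ?_
  filter_upwards [hu, hv] with x hx hx'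
  rw [hx, hx', RCLike.inner_apply]

theorem isFormalAdjoint_opOn_compactOp : (opOn γ P hP).IsFormalAdjoint (compactOp γ) := by
  intro u v
  obtain ⟨f, hf, huf, hLuf⟩ := exists_ae_eq_of_mem_domain u
  obtain ⟨g, hg, hvg, hLvg⟩ := exists_ae_eq_of_mem_domain v
  have hsymm := congrArg conj (integral_diskOp_mul_conj_comm (γ := γ) (hP hf) hg)
  rw [← integral_conj, ← integral_conj] at hsymm
  calc inner ℂ (opOn γ P hP u) (v : DiskL2 γ)
      = ∫ z, g z * conj (diskOp γ f z) ∂diskMeasure γ := inner_eq_integral hLuf hvg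
    _ = ∫ z, diskOp γ g z * conj (f z) ∂diskMeasure γ := by
      simpa only [map_mul, Complex.conj_conj, mul_comm] using hsymm
    _ = inner ℂ (u : DiskL2 γ) (compactOp γ v) := (inner_eq_integral huf hLvg).symm

theorem re_form_compactOp_nonneg (u : (compactOp γ).domain) :
    0 ≤ (form (compactOp γ) u u).re := by
  obtain ⟨f, hf, huf, hLuf⟩ := exists_ae_eq_of_mem_domain u
  have hform : form (compactOp γ) u u = ∫ z, diskOp γ f z * conj (f z) ∂diskMeasure γ :=
    inner_eq_integral huf hLuf
  exact hform ▸ re_integral_diskOp_mul_conj_nonneg hf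

theorem locallyIntegrableOn_diskMeasure {v : ℂ → ℂ} (hv : MemLp v 2 (diskMeasure γ)) :
    LocallyIntegrableOn v (ball 0 1) (diskMeasure γ) := by
  rw [locallyIntegrableOn_iff isOpen_ball.isLocallyClosed]
  intro K hK hKc
  have hdensity : ContinuousOn (fun z => bdf z ^ γ) K := fun z hz =>
    ((contDiff_bdf (n := 1)).continuous.continuousAt.rpow_const
      (Or.inl (bdf_pos (hK hz)).ne')).continuousWithinAt
  have hfinite : diskMeasure γ K < ⊤ := by
    rw [diskMeasure, withDensity_apply _ hKc.measurableSet,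
      Measure.restrict_restrict hKc.measurableSet, Set.inter_eq_left.2 hK]
    exact (hdensity.integrableOn_compact hKc).lintegral_lt_top
  have : IsFiniteMeasure ((diskMeasure γ).restrict K) := ⟨by simpa using hfinite⟩
  exact (hv.restrict K).integrable one_le_two

theorem ae_eq_zero_of_integral_smoothCompact_mul {v : ℂ → ℂ} (hv : MemLp v 2 (diskMeasure γ))
    (h : ∀ φ ∈ smoothCompact, ∫ z, φ z * v z ∂diskMeasure γ = 0) : v =ᵐ[diskMeasure γ] 0 := by
  have hzero := isOpen_ball.ae_eq_zero_of_integral_contDiff_smul_eq_zero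
    (locallyIntegrableOn_diskMeasure hv) fun g hg hcpt hball => by
      have hsupp : tsupport (fun z => (g z : ℂ)) ⊆ tsupport g :=
        closure_mono fun z hz h0 => hz (by simp only [h0, Complex.ofReal_zero])
      simpa using h (fun z => (g z : ℂ)) ⟨Complex.ofRealCLM.contDiff.comp hg,
        hcpt.of_isClosed_subset (isClosed_tsupport _) hsupp, hsupp.trans hball⟩
  filter_upwards [hzero, ae_mem_ball γ] with z hz hzb using hz hzb

theorem dense_domain_compactOp (γ : ℝ) : Dense ((compactOp γ).domain : Set (DiskL2 γ)) := by
  rw [Submodule.dense_iff_topologicalClosure_eq_top, Submodule.topologicalClosure_eq_top_iff,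
    Submodule.eq_bot_iff]
  intro v hv
  rw [Lp.eq_zero_iff_ae_eq_zero]
  refine ae_eq_zero_of_integral_smoothCompact_mul (Lp.memLp v) fun φ hφ => ?_
  have hconj := conj_mem_smoothCompact hφ
  have hmem := memLp_smoothCompact (γ := γ) hconj
  have hinner := (Submodule.mem_orthogonal _ _).1 hv (hmem.toLp _)
    (LinearPMap.mem_domain_of_mem_graph
      (toLp_mem_graph_opOn hconj hmem (memLp_diskOp_smoothCompact hconj)))
  rw [inner_eq_integral hmem.coeFn_toLp EventuallyEq.rfl] at hinner
  simpa only [Complex.conj_conj, mul_comm] using hinner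

end Realization

section Flat

section NormedSpace

variable {E F : Type*} [NormedAddCommGroup E] [NormedSpace ℝ E]
  [NormedAddCommGroup F] [NormedSpace ℝ F]

theorem uniqueDiffOn_closedBall_one : UniqueDiffOn ℝ (closedBall (0 : E) 1) :=
  uniqueDiffOn_convex (convex_closedBall _ _)
    ⟨0, ball_subset_interior_closedBall (mem_ball_self one_pos)⟩

variable [Nontrivial E]

theorem exists_norm_eq_one_norm_sub_eq {z : E} (hz : ‖z‖ ≤ 1) :
    ∃ e : E, ‖e‖ = 1 ∧ ‖z - e‖ = 1 - ‖z‖ := by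
  rcases eq_or_ne z 0 with rfl | hz0
  · obtain ⟨e, he⟩ := exists_norm_eq E zero_le_one
    exact ⟨e, he, by simpa using he⟩
  · have hunit : ‖‖z‖⁻¹ • z‖ = 1 := norm_smul_inv_norm (𝕜 := ℝ) hz0
    refine ⟨‖z‖⁻¹ • z, hunit, ?_⟩
    have hsub : z - ‖z‖⁻¹ • z = (‖z‖ - 1) • ‖z‖⁻¹ • z := by
      rw [sub_smul, one_smul, smul_smul, mul_inv_cancel₀ (norm_ne_zero_iff.2 hz0), one_smul]
    rw [hsub, norm_smul, hunit, mul_one, Real.norm_of_nonpos (by linarith), neg_sub]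

theorem norm_le_mul_pow_succ_of_norm_fderivWithin_le {f : E → F} {C : ℝ} {N : ℕ}
    (hf : DifferentiableOn ℝ f (closedBall 0 1)) (hzero : ∀ e, ‖e‖ = 1 → f e = 0)
    (hbound : ∀ z ∈ closedBall (0 : E) 1,
      ‖fderivWithin ℝ f (closedBall 0 1) z‖ ≤ C * (1 - ‖z‖) ^ N)
    {z : E} (hz : z ∈ closedBall (0 : E) 1) : ‖f z‖ ≤ C * (1 - ‖z‖) ^ (N + 1) := by
  have hC : 0 ≤ C := by
    simpa using (norm_nonneg _).trans (hbound 0 (mem_closedBall_self zero_le_one))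
  obtain ⟨e, he, hze⟩ := exists_norm_eq_one_norm_sub_eq (mem_closedBall_zero_iff.1 hz)
  have hseg : segment ℝ e z ⊆ closedBall 0 1 :=
    (convex_closedBall _ _).segment_subset (mem_closedBall_zero_iff.2 he.le) hz
  have hnorm : ∀ w ∈ segment ℝ e z, ‖z‖ ≤ ‖w‖ := fun w hw => by
    have hwe := norm_sub_le_of_mem_segment hw
    have hew := norm_sub_norm_le e w
    rw [norm_sub_rev] at hew
    linarith
  have hmean := (convex_segment e z).norm_image_sub_le_of_norm_hasFDerivWithin_le
    (C := C * (1 - ‖z‖) ^ N) (fun w hw => (hf w (hseg hw)).hasFDerivWithinAt.mono hseg)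
    (fun w hw => (hbound w (hseg hw)).trans <| by
      have hw1 : 0 ≤ 1 - ‖w‖ := sub_nonneg.2 (mem_closedBall_zero_iff.1 (hseg hw))
      have := hnorm w hw
      gcongr)
    (left_mem_segment ℝ e z) (right_mem_segment ℝ e z)
  rwa [hzero e he, sub_zero, hze, mul_assoc, ← pow_succ] at hmean

theorem exists_norm_iteratedFDerivWithin_le [ProperSpace E] {f : E → F}
    (hf : ContDiffOn ℝ ∞ f (closedBall 0 1))
    (hzero : ∀ n e, ‖e‖ = 1 → iteratedFDerivWithin ℝ n f (closedBall 0 1) e = 0) (N n : ℕ) :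
    ∃ C : ℝ, ∀ z ∈ closedBall (0 : E) 1,
      ‖iteratedFDerivWithin ℝ n f (closedBall 0 1) z‖ ≤ C * (1 - ‖z‖) ^ N := by
  induction N generalizing n with
  | zero =>
    have hcont : ContinuousOn (iteratedFDerivWithin ℝ n f (closedBall 0 1)) (closedBall 0 1) :=
      hf.continuousOn_iteratedFDerivWithin (by exact_mod_cast le_top) uniqueDiffOn_closedBall_one
    simpa only [pow_zero, mul_one] using
      (isCompact_closedBall (0 : E) 1).exists_bound_of_continuousOn hcont
  | succ N ih =>
    obtain ⟨C, hC⟩ := ih (n + 1)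
    refine ⟨C, fun z hz => norm_le_mul_pow_succ_of_norm_fderivWithin_le
      (hf.differentiableOn_iteratedFDerivWithin (by exact_mod_cast ENat.natCast_lt_top n)
        uniqueDiffOn_closedBall_one) (hzero n) (fun w hw => ?_) hz⟩
    rw [norm_fderivWithin_iteratedFDerivWithin]
    exact hC w hw

end NormedSpace

variable {γ : ℝ} {f : ℂ → ℂ} {z : ℂ}

theorem bdf_le_one (z : ℂ) : bdf z ≤ 1 :=
  sub_le_self _ (sq_nonneg _)

theorem one_sub_norm_le_bdf (hz : z ∈ ball (0 : ℂ) 1) : 1 - ‖z‖ ≤ bdf z :=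
  sub_le_sub_left (pow_le_of_le_one (norm_nonneg z) (mem_ball_zero_iff.1 hz).le two_ne_zero) 1

theorem memLp_of_norm_le_mul_pow (hc : ContinuousOn f (ball 0 1))
    (hb : ∀ N : ℕ, ∃ C : ℝ, ∀ z ∈ ball (0 : ℂ) 1, ‖f z‖ ≤ C * (1 - ‖z‖) ^ N) :
    MemLp f 2 (diskMeasure γ) := by
  rw [memLp_two_iff_integrable_sq_norm (aestronglyMeasurable_diskMeasure hc),
    integrable_diskMeasure_iff]
  obtain ⟨N, hN⟩ := exists_nat_ge (-γ)
  obtain ⟨C, hC⟩ := hb N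
  have hcont : ContinuousOn (fun z => bdf z ^ γ • ‖f z‖ ^ 2) (ball 0 1) :=
    ContinuousOn.smul (fun z hz => ((contDiff_bdf (n := 1)).continuous.continuousAt.rpow_const
      (Or.inl (bdf_pos hz).ne')).continuousWithinAt) (hc.norm.pow 2)
  refine IntegrableOn.of_bound measure_ball_lt_top (hcont.aestronglyMeasurable measurableSet_ball)
    (C ^ 2) ?_
  filter_upwards [ae_restrict_mem measurableSet_ball] with z hz
  have hx := bdf_pos hz
  have hpow : (1 - ‖z‖) ^ N ≤ bdf z ^ N :=
    pow_le_pow_left₀ (sub_nonneg.2 (mem_ball_zero_iff.1 hz).le) (one_sub_norm_le_bdf hz) N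
  have hf : ‖f z‖ ^ 2 ≤ C ^ 2 * (bdf z ^ N) ^ 2 := by
    have hC0 : 0 ≤ C := by simpa using (norm_nonneg _).trans (hC 0 (mem_ball_self one_pos))
    rw [← mul_pow]
    exact pow_le_pow_left₀ (norm_nonneg _) ((hC z hz).trans (by gcongr)) 2
  have hweight : bdf z ^ γ * (bdf z ^ N) ^ 2 ≤ 1 := by
    rw [← pow_mul, ← Real.rpow_natCast, ← Real.rpow_add hx]
    refine Real.rpow_le_one hx.le (bdf_le_one z) ?_
    push_cast
    linarith [N.cast_nonneg (α := ℝ)]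
  have : 0 ≤ bdf z ^ γ := Real.rpow_nonneg hx.le _
  rw [smul_eq_mul, Real.norm_of_nonneg (by positivity)]
  calc bdf z ^ γ * ‖f z‖ ^ 2 ≤ bdf z ^ γ * (C ^ 2 * (bdf z ^ N) ^ 2) := by gcongr
    _ = C ^ 2 * (bdf z ^ γ * (bdf z ^ N) ^ 2) := by ring
    _ ≤ C ^ 2 := mul_le_of_le_one_right (sq_nonneg C) hweight

theorem exists_norm_iteratedFDeriv_le (hf : f ∈ smoothFlat) (N n : ℕ) :
    ∃ C : ℝ, ∀ z ∈ ball (0 : ℂ) 1, ‖iteratedFDeriv ℝ n f z‖ ≤ C * (1 - ‖z‖) ^ N := by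
  obtain ⟨C, hC⟩ := exists_norm_iteratedFDerivWithin_le hf.1 hf.2 N n
  refine ⟨C, fun z hz => ?_⟩
  have hz' := ball_subset_closedBall hz
  rw [← iteratedFDerivWithin_eq_iteratedFDeriv uniqueDiffOn_closedBall_one
    ((contDiffAt_of_mem (smoothFlat_le hf) hz).of_le (by exact_mod_cast le_top)) hz']
  exact hC z hz'

theorem memLp_smoothFlat (hf : f ∈ smoothFlat) : MemLp f 2 (diskMeasure γ) :=
  memLp_of_norm_le_mul_pow (ContDiffOn.continuousOn (smoothFlat_le hf)) fun N => by
    simpa only [norm_iteratedFDeriv_zero] using exists_norm_iteratedFDeriv_le hf N 0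

theorem norm_iteratedFDeriv_two : ‖iteratedFDeriv ℝ 2 f z‖ = ‖fderiv ℝ (fderiv ℝ f) z‖ := by
  rw [← norm_iteratedFDeriv_fderiv (n := 1), norm_iteratedFDeriv_one]

theorem norm_clm_apply_apply_le {E F : Type*} [NormedAddCommGroup E] [NormedSpace ℝ E]
    [NormedAddCommGroup F] [NormedSpace ℝ F] (B : E →L[ℝ] E →L[ℝ] F) {v : E} (hv : ‖v‖ ≤ 1) :
    ‖B v v‖ ≤ ‖B‖ :=
  ((B v).unit_le_opNorm v hv).trans (B.unit_le_opNorm v hv)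

theorem norm_diskOp_le (hf : ContDiffAt ℝ 2 f z) (hz : z ∈ ball (0 : ℂ) 1) :
    ‖diskOp γ f z‖ ≤ 3 * ‖iteratedFDeriv ℝ 2 f z‖ + (|2 + 2 * γ| + 1) * ‖iteratedFDeriv ℝ 1 f z‖ +
      (γ + 1) ^ 2 * ‖iteratedFDeriv ℝ 0 f z‖ := by
  rw [norm_iteratedFDeriv_two, norm_iteratedFDeriv_one, norm_iteratedFDeriv_zero, diskOp_eq hf]
  set B := fderiv ℝ (fderiv ℝ f) z
  set D := fderiv ℝ f z
  have hz1 : ‖z‖ ≤ 1 := (mem_ball_zero_iff.1 hz).le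
  have hDz : ‖D z‖ ≤ ‖D‖ := D.unit_le_opNorm z hz1
  have hlaplacian : ‖-(bdf z : ℂ) * (B 1 1 + B Complex.I Complex.I)‖ ≤ ‖B‖ + ‖B‖ := by
    rw [norm_mul, norm_neg, Complex.norm_real, Real.norm_of_nonneg (bdf_pos hz).le]
    refine (mul_le_of_le_one_left (norm_nonneg _) (bdf_le_one z)).trans ?_
    exact norm_add_le_of_le (norm_clm_apply_apply_le B norm_one.le)
      (norm_clm_apply_apply_le B Complex.norm_I.le)
  have hradial : ‖((2 + 2 * γ : ℝ) : ℂ) * D z‖ ≤ |2 + 2 * γ| * ‖D‖ := by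
    rw [norm_mul, Complex.norm_real, Real.norm_eq_abs]
    gcongr
  have hangular : ‖B (Complex.I * z) (Complex.I * z) - D z‖ ≤ ‖B‖ + ‖D‖ :=
    norm_sub_le_of_le (norm_clm_apply_apply_le B (by simpa using hz1)) hDz
  have hpotential : ‖(((γ + 1) ^ 2 : ℝ) : ℂ) * f z‖ ≤ (γ + 1) ^ 2 * ‖f z‖ := by
    rw [norm_mul, Complex.norm_real, Real.norm_of_nonneg (sq_nonneg _)]
  refine (norm_add_le_of_le (norm_sub_le_of_le (norm_add_le_of_le hlaplacian hradial) hangular)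
    hpotential).trans_eq ?_
  ring

theorem memLp_diskOp_smoothFlat (hf : f ∈ smoothFlat) : MemLp (diskOp γ f) 2 (diskMeasure γ) := by
  refine memLp_of_norm_le_mul_pow (continuousOn_diskOp (smoothFlat_le hf)) fun N => ?_
  choose C hC using exists_norm_iteratedFDeriv_le hf N
  refine ⟨3 * C 2 + (|2 + 2 * γ| + 1) * C 1 + (γ + 1) ^ 2 * C 0, fun z hz => ?_⟩
  have hsmooth := (contDiffAt_of_mem (smoothFlat_le hf) hz).of_le (m := 2) (by norm_cast)
  calc ‖diskOp γ f z‖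
      ≤ 3 * ‖iteratedFDeriv ℝ 2 f z‖ + (|2 + 2 * γ| + 1) * ‖iteratedFDeriv ℝ 1 f z‖ +
        (γ + 1) ^ 2 * ‖iteratedFDeriv ℝ 0 f z‖ := norm_diskOp_le hsmooth hz
    _ ≤ 3 * (C 2 * (1 - ‖z‖) ^ N) + (|2 + 2 * γ| + 1) * (C 1 * (1 - ‖z‖) ^ N) +
        (γ + 1) ^ 2 * (C 0 * (1 - ‖z‖) ^ N) := by
      gcongr <;> exact hC _ z hz
    _ = (3 * C 2 + (|2 + 2 * γ| + 1) * C 1 + (γ + 1) ^ 2 * C 0) * (1 - ‖z‖) ^ N := by ring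

end Flat

section Collar

theorem measurableSet_bdf_le (s : ℝ) : MeasurableSet {z : ℂ | bdf z ≤ s} :=
  measurableSet_le (contDiff_bdf (n := 0)).continuous.measurable measurable_const

theorem volume_bdf_le_inter_ball_le {s : ℝ} (hs : 0 ≤ s) :
    volume ({z | bdf z ≤ s} ∩ ball (0 : ℂ) 1) ≤ ENNReal.ofReal (Real.pi * s) := by
  have hsub : {z | bdf z ≤ s} ∩ ball (0 : ℂ) 1 ⊆ ball 0 1 \ ball 0 √(1 - s) := by
    rintro z ⟨hz, hz1⟩
    refine ⟨hz1, fun hball => ?_⟩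
    have hsq : ‖z‖ ^ 2 < 1 - s := (Real.lt_sqrt (norm_nonneg z)).1 (mem_ball_zero_iff.1 hball)
    have hbdf : 1 - ‖z‖ ^ 2 ≤ s := hz
    linarith
  have hball : ball (0 : ℂ) √(1 - s) ⊆ ball 0 1 :=
    ball_subset_ball (Real.sqrt_le_one.2 (by linarith))
  have hvolume (r : ℝ) : volume.real (ball (0 : ℂ) r) = Real.pi * max r 0 ^ 2 := by
    rw [Measure.real, Complex.volume_ball, ENNReal.toReal_mul, ENNReal.toReal_pow,
      ENNReal.toReal_ofReal', mul_comm, ENNReal.coe_toReal, NNReal.coe_real_pi]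
  refine (measure_mono hsub).trans ?_
  rw [← ofReal_measureReal (measure_ne_top_of_subset Set.sdiff_subset measure_ball_lt_top.ne),
    measureReal_sdiff hball measurableSet_ball, hvolume, hvolume, max_eq_left zero_le_one,
    max_eq_left (Real.sqrt_nonneg _), Real.sq_sqrt', ← mul_sub]
  refine ENNReal.ofReal_le_ofReal (mul_le_mul_of_nonneg_left ?_ Real.pi_nonneg)
  linarith [le_max_left (1 - s) 0]

theorem diskMeasure_bdf_le_le {γ s : ℝ} (hγ : 1 ≤ γ) (hs : 0 ≤ s) :
    diskMeasure γ {z | bdf z ≤ s} ≤ ENNReal.ofReal (Real.pi * s ^ 2) := by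
  have hm := measurableSet_bdf_le s
  rw [diskMeasure, withDensity_apply _ hm, Measure.restrict_restrict hm]
  calc ∫⁻ z in {z | bdf z ≤ s} ∩ ball 0 1, ENNReal.ofReal (bdf z ^ γ)
      ≤ ∫⁻ _ in {z | bdf z ≤ s} ∩ ball (0 : ℂ) 1, ENNReal.ofReal s :=
        setLIntegral_mono measurable_const fun z hz => ENNReal.ofReal_le_ofReal <|
          (Real.rpow_le_self_of_le_one (bdf_pos hz.2).le (bdf_le_one z) hγ).trans hz.1
    _ = ENNReal.ofReal s * volume ({z | bdf z ≤ s} ∩ ball (0 : ℂ) 1) := setLIntegral_const _ _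
    _ ≤ ENNReal.ofReal s * ENNReal.ofReal (Real.pi * s) := by
        gcongr
        exact volume_bdf_le_inter_ball_le hs
    _ = ENNReal.ofReal (Real.pi * s ^ 2) := by
        rw [← ENNReal.ofReal_mul hs]
        congr 1
        ring

theorem isFiniteMeasure_diskMeasure {γ : ℝ} (hγ : 1 ≤ γ) : IsFiniteMeasure (diskMeasure γ) where
  measure_univ_lt_top := by
    rw [← Set.eq_univ_of_forall bdf_le_one]
    exact (diskMeasure_bdf_le_le hγ zero_le_one).trans_lt ENNReal.ofReal_lt_top

end Collar

section Cutoff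

theorem tsupport_deriv_smoothTransition_subset :
    tsupport (deriv Real.smoothTransition) ⊆ Set.Icc 0 1 := by
  refine closure_minimal (fun t ht => ?_) isClosed_Icc
  by_contra hout
  rw [Set.mem_Icc, not_and_or, not_le, not_le] at hout
  refine ht ?_
  rcases hout with ht0 | ht1
  · have hnear : Real.smoothTransition =ᶠ[𝓝 t] fun _ => 0 := by
      filter_upwards [gt_mem_nhds ht0] with y hy
      exact Real.smoothTransition.zero_of_nonpos hy.le
    rw [hnear.deriv_eq, deriv_const]
  · have hnear : Real.smoothTransition =ᶠ[𝓝 t] fun _ => 1 := by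
      filter_upwards [lt_mem_nhds ht1] with y hy
      exact Real.smoothTransition.one_of_one_le hy.le
    rw [hnear.deriv_eq, deriv_const]

theorem contDiff_deriv_smoothTransition : ContDiff ℝ ∞ (deriv Real.smoothTransition) :=
  (contDiff_infty_iff_deriv.1 Real.smoothTransition.contDiff).2

theorem exists_abs_deriv_smoothTransition_le : ∃ K : ℝ, ∀ t,
    |deriv Real.smoothTransition t| ≤ K ∧ |deriv (deriv Real.smoothTransition) t| ≤ K := by
  have hcpt : HasCompactSupport (deriv Real.smoothTransition) :=
    isCompact_Icc.of_isClosed_subset (isClosed_tsupport _) tsupport_deriv_smoothTransition_subset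
  obtain ⟨K, hK⟩ := hcpt.exists_bound_of_continuous contDiff_deriv_smoothTransition.continuous
  obtain ⟨K', hK'⟩ := hcpt.deriv.exists_bound_of_continuous
    (contDiff_deriv_smoothTransition.continuous_deriv (by simp))
  exact ⟨max K K', fun t => ⟨(hK t).trans (le_max_left _ _), (hK' t).trans (le_max_right _ _)⟩⟩

/-- The cutoff function `χ(n x)` in the variable `x`, equal to `0` for `x ≤ n⁻¹` and to `1` for
`x ≥ 2 n⁻¹`. -/
noncomputable def cutoff (n t : ℝ) : ℝ := Real.smoothTransition (n * t - 1)

theorem contDiff_cutoff (n : ℝ) : ContDiff ℝ ∞ (cutoff n) :=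
  Real.smoothTransition.contDiff.comp ((contDiff_const.mul contDiff_id).sub contDiff_const)

theorem continuous_cutoff_bdf (n : ℝ) : Continuous fun z => (cutoff n (bdf z) : ℂ) :=
  Complex.continuous_ofReal.comp
    ((contDiff_cutoff n).continuous.comp (contDiff_bdf (n := 0)).continuous)

theorem norm_cutoff_le_one (n t : ℝ) : ‖(cutoff n t : ℂ)‖ ≤ 1 := by
  rw [Complex.norm_real, cutoff, Real.norm_of_nonneg (Real.smoothTransition.nonneg _)]
  exact Real.smoothTransition.le_one _

theorem deriv_comp_affine (S : ℝ → ℝ) (n t : ℝ) :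
    deriv (fun t => S (n * t - 1)) t = n * deriv S (n * t - 1) := by
  rw [deriv_comp_mul_left n (fun t => S (t - 1)), deriv_comp_sub_const, smul_eq_mul]

theorem deriv_cutoff (n t : ℝ) :
    deriv (cutoff n) t = n * deriv Real.smoothTransition (n * t - 1) :=
  deriv_comp_affine _ n t

theorem deriv_deriv_cutoff (n t : ℝ) :
    deriv (deriv (cutoff n)) t = n * (n * deriv (deriv Real.smoothTransition) (n * t - 1)) := by
  rw [funext (deriv_cutoff n), deriv_const_mul_field, deriv_comp_affine]

theorem deriv_cutoff_eq_zero {n t : ℝ} (hn : 0 < n) (ht : 2 / n < t) :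
    deriv (cutoff n) t = 0 ∧ deriv (deriv (cutoff n)) t = 0 := by
  have hout : n * t - 1 ∉ tsupport (deriv Real.smoothTransition) := fun hmem => by
    have hle := (tsupport_deriv_smoothTransition_subset hmem).2
    rw [div_lt_iff₀' hn] at ht
    linarith
  rw [deriv_cutoff, deriv_deriv_cutoff, image_eq_zero_of_notMem_tsupport hout,
    image_eq_zero_of_notMem_tsupport fun hmem => hout (tsupport_deriv_subset hmem)]
  simp

theorem cutoff_mul_mem_smoothCompact {n : ℝ} (hn : 0 < n) {g : ℂ → ℂ} (hg : ContDiff ℝ ∞ g) :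
    (fun z => (cutoff n (bdf z) : ℂ) * g z) ∈ smoothCompact := by
  have hbdf : Continuous bdf := (contDiff_bdf (n := 0)).continuous
  have hsub : tsupport (fun z => (cutoff n (bdf z) : ℂ) * g z) ⊆ {z | n⁻¹ ≤ bdf z} := by
    refine closure_minimal (fun z hz => ?_) (isClosed_le continuous_const hbdf)
    refine (not_lt.1 fun hlt => hz ?_ : n⁻¹ ≤ bdf z)
    have harg : n * bdf z - 1 ≤ 0 := sub_nonpos.2 (by
      simpa only [mul_inv_cancel₀ hn.ne'] using mul_le_mul_of_nonneg_left hlt.le hn.le)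
    simp only [cutoff, Real.smoothTransition.zero_of_nonpos harg, Complex.ofReal_zero, zero_mul]
  have hball : {z | n⁻¹ ≤ bdf z} ⊆ ball (0 : ℂ) 1 := fun z hz => by
    have hpos : 0 < 1 - ‖z‖ ^ 2 := (inv_pos.2 hn).trans_le hz
    exact mem_ball_zero_iff.2 ((sq_lt_one_iff₀ (norm_nonneg z)).1 (sub_pos.1 hpos))
  refine ⟨(Complex.ofRealCLM.contDiff.comp ((contDiff_cutoff n).comp contDiff_bdf)).mul hg, ?_,
    hsub.trans hball⟩
  exact (isCompact_closedBall (0 : ℂ) 1).of_isClosed_subset (isClosed_tsupport _)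
    (hsub.trans (hball.trans ball_subset_closedBall))

variable {γ : ℝ} {g : ℂ → ℂ}

theorem norm_diskOp_comp_bdf_mul_sub_le {h : ℝ → ℝ} {M : ℝ} {z : ℂ} (hz : z ∈ ball (0 : ℂ) 1)
    (hh : ContDiffAt ℝ 2 h (bdf z)) (hg : ContDiffAt ℝ 2 g z) (hM : |deriv h (bdf z)| ≤ M)
    (hM' : bdf z * |deriv (deriv h) (bdf z)| ≤ 2 * M) :
    ‖diskOp γ (fun y => (h (bdf y) : ℂ) * g y) z - (h (bdf z) : ℂ) * diskOp γ g z‖ ≤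
      M * ((12 + 4 * |1 + γ|) * ‖g z‖ + 4 * ‖radial g z‖) := by
  have hx := (bdf_pos hz).le
  have hx1 := bdf_le_one z
  have : 0 ≤ M := (abs_nonneg _).trans hM
  set x := bdf z
  set d := deriv h x
  set d' := deriv (deriv h) x
  have hsecond : |-4 * x * (1 - x) * d'| ≤ 8 * M := by
    rw [show -4 * x * (1 - x) * d' = (1 - x) * (-4 * (x * d')) by ring, abs_mul,
      abs_of_nonneg (sub_nonneg.2 hx1), abs_mul, abs_mul, abs_of_nonneg hx]
    refine (mul_le_of_le_one_left (by positivity) (by linarith)).trans ?_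
    rw [abs_neg, abs_of_pos four_pos]
    linarith
  have hfirst : |4 * x * d| ≤ 4 * M := by
    rw [abs_mul, abs_of_nonneg (by positivity)]
    gcongr
    linarith
  have hdrift : |4 * (1 + γ) * (1 - x) * d| ≤ 4 * |1 + γ| * M := by
    rw [abs_mul, abs_mul, abs_mul, abs_of_nonneg (sub_nonneg.2 hx1), abs_of_pos four_pos]
    refine mul_le_mul (mul_le_of_le_one_right (by positivity) (by linarith)) hM ?_ ?_ <;> positivity
  have hcoeff : |-4 * x * (1 - x) * d' + 4 * x * d - 4 * (1 + γ) * (1 - x) * d| ≤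
      8 * M + 4 * M + 4 * |1 + γ| * M :=
    (abs_sub _ _).trans (add_le_add ((abs_add_le _ _).trans (add_le_add hsecond hfirst)) hdrift)
  rw [diskOp_comp_bdf_mul hh hg, add_assoc, add_sub_cancel_left]
  calc _ ≤ (8 * M + 4 * M + 4 * |1 + γ| * M) * ‖g z‖ + 4 * M * ‖radial g z‖ := by
        refine norm_add_le_of_le ?_ ?_ <;> rw [norm_mul, Complex.norm_real] <;> gcongr <;>
          assumption
    _ = M * ((12 + 4 * |1 + γ|) * ‖g z‖ + 4 * ‖radial g z‖) := by ring

theorem exists_norm_diskOp_cutoff_mul_sub_le (γ : ℝ) (hg : ContDiff ℝ 2 g) :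
    ∃ C : ℝ, 0 ≤ C ∧ ∀ n : ℝ, 0 < n → ∀ z ∈ ball (0 : ℂ) 1,
      ‖diskOp γ (fun y => (cutoff n (bdf y) : ℂ) * g y) z - (cutoff n (bdf z) : ℂ) * diskOp γ g z‖ ≤
        {z | bdf z ≤ 2 / n}.indicator (fun _ => n * C) z := by
  obtain ⟨K, hK⟩ := exists_abs_deriv_smoothTransition_le
  have : 0 ≤ K := (abs_nonneg _).trans (hK 0).1
  have hradial : Continuous (radial g) :=
    (hg.continuous_fderiv two_ne_zero).clm_apply continuous_id
  have hcont : Continuous fun z => K * ((12 + 4 * |1 + γ|) * ‖g z‖ + 4 * ‖radial g z‖) := by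
    have := hg.continuous
    fun_prop
  obtain ⟨C, hC⟩ := (isCompact_closedBall (0 : ℂ) 1).exists_bound_of_continuousOn hcont.continuousOn
  refine ⟨C, (norm_nonneg _).trans (hC 0 (mem_closedBall_self zero_le_one)), fun n hn z hz => ?_⟩
  have hcutoff := (contDiff_cutoff n).contDiffAt.of_le (x := bdf z) (m := 2) (by norm_cast)
  by_cases hcollar : bdf z ≤ 2 / n
  · rw [Set.indicator_of_mem (by exact hcollar)]
    have hfirst : |deriv (cutoff n) (bdf z)| ≤ n * K := by
      rw [deriv_cutoff, abs_mul, abs_of_pos hn]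
      exact mul_le_mul_of_nonneg_left (hK _).1 hn.le
    have hsecond : bdf z * |deriv (deriv (cutoff n)) (bdf z)| ≤ 2 * (n * K) := by
      rw [deriv_deriv_cutoff, abs_mul, abs_mul, abs_of_pos hn, ← mul_assoc]
      gcongr
      exacts [(le_div_iff₀ hn).1 hcollar, (hK _).2]
    refine (norm_diskOp_comp_bdf_mul_sub_le hz hcutoff hg.contDiffAt hfirst hsecond).trans ?_
    rw [mul_assoc]
    exact mul_le_mul_of_nonneg_left
      ((le_abs_self _).trans (hC z (ball_subset_closedBall hz))) hn.le
  · rw [Set.indicator_of_notMem (by exact hcollar)]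
    obtain ⟨hfirst, hsecond⟩ := deriv_cutoff_eq_zero hn (not_le.1 hcollar)
    simpa using norm_diskOp_comp_bdf_mul_sub_le (γ := γ) (M := 0) hz hcutoff hg.contDiffAt
      (by rw [hfirst, abs_zero]) (by rw [hsecond, abs_zero, mul_zero, mul_zero])

end Cutoff

section Limit

section CauchySchwarz

variable {α E ι : Type*} [MeasurableSpace α] {μ : Measure α} [IsFiniteMeasure μ]
  [NormedAddCommGroup E]

theorem setIntegral_norm_le_sqrt_mul_sqrt {v : α → E} (hv : MemLp v 2 μ) (s : Set α) :
    ∫ x in s, ‖v x‖ ∂μ ≤ √(μ.real s) * √(∫ x in s, ‖v x‖ ^ 2 ∂μ) := by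
  have hholder := integral_mul_norm_le_Lp_mul_Lq (μ := μ.restrict s) Real.HolderConjugate.two_two
    (f := fun _ => (1 : ℝ)) (g := fun x => ‖v x‖) (by simpa using memLp_const 1)
    (by simpa using (hv.restrict s).norm)
  simpa [Real.sqrt_eq_rpow] using hholder

theorem tendsto_integral_mul_of_norm_le_indicator {l : Filter ι} {v : α → ℂ} (hv : MemLp v 2 μ)
    {A : ι → Set α} (hA : ∀ i, MeasurableSet (A i)) (hA0 : Tendsto (fun i => μ (A i)) l (𝓝 0))
    {c : ι → ℝ} {M : ℝ} (hc : ∀ᶠ i in l, 0 ≤ c i) (hM : ∀ᶠ i in l, c i * √(μ.real (A i)) ≤ M)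
    {e : ι → α → ℂ}
    (he : ∀ᶠ i in l, ∀ᵐ x ∂μ, ‖e i x‖ ≤ (A i).indicator (fun _ => c i) x) :
    Tendsto (fun i => ∫ x, e i x * v x ∂μ) l (𝓝 0) := by
  have hsq : Integrable (fun x => ‖v x‖ ^ 2) μ := (memLp_two_iff_integrable_sq_norm hv.1).1 hv
  have hlim : Tendsto (fun i => M * √(∫ x in A i, ‖v x‖ ^ 2 ∂μ)) l (𝓝 0) := by
    simpa using (hsq.tendsto_setIntegral_nhds_zero hA0).sqrt.const_mul M
  refine squeeze_zero_norm' ?_ hlim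
  filter_upwards [hc, hM, he] with i hci hMi hei
  have hnorm : ∀ᵐ x ∂μ, ‖e i x * v x‖ ≤ (A i).indicator (fun x => c i * ‖v x‖) x := by
    filter_upwards [hei] with x hx
    rw [norm_mul]
    refine (mul_le_mul_of_nonneg_right hx (norm_nonneg _)).trans_eq ?_
    by_cases hxA : x ∈ A i <;> simp [hxA]
  have hint : Integrable (fun x => ‖v x‖) μ := (hv.integrable one_le_two).norm
  calc ‖∫ x, e i x * v x ∂μ‖
      ≤ ∫ x, (A i).indicator (fun x => c i * ‖v x‖) x ∂μ :=
        norm_integral_le_of_norm_le ((hint.const_mul _).indicator (hA i)) hnorm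
    _ = c i * ∫ x in A i, ‖v x‖ ∂μ := by rw [integral_indicator (hA i), integral_const_mul]
    _ ≤ c i * (√(μ.real (A i)) * √(∫ x in A i, ‖v x‖ ^ 2 ∂μ)) := by
        gcongr
        exact setIntegral_norm_le_sqrt_mul_sqrt hv (A i)
    _ ≤ M * √(∫ x in A i, ‖v x‖ ^ 2 ∂μ) := by
        rw [← mul_assoc]
        gcongr

end CauchySchwarz

variable {γ : ℝ} {g v : ℂ → ℂ}

theorem tendsto_diskMeasure_collar (hγ : 1 ≤ γ) :
    Tendsto (fun n : ℝ => diskMeasure γ {z | bdf z ≤ 2 / n}) atTop (𝓝 0) := by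
  have hbound : Tendsto (fun n : ℝ => ENNReal.ofReal (Real.pi * (2 / n) ^ 2)) atTop (𝓝 0) := by
    have hdiv : Tendsto (fun n : ℝ => 2 / n) atTop (𝓝 0) := tendsto_const_nhds.div_atTop tendsto_id
    simpa using ENNReal.tendsto_ofReal ((hdiv.pow 2).const_mul Real.pi)
  refine tendsto_of_tendsto_of_tendsto_of_le_of_le' tendsto_const_nhds hbound
    (Eventually.of_forall fun _ => zero_le) ?_
  filter_upwards [eventually_gt_atTop 0] with n hn
  exact diskMeasure_bdf_le_le hγ (by positivity)

theorem mul_sqrt_diskMeasure_collar_le (hγ : 1 ≤ γ) {n : ℝ} (hn : 0 < n) :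
    n * √((diskMeasure γ).real {z | bdf z ≤ 2 / n}) ≤ 2 * √Real.pi := by
  have hcollar : (diskMeasure γ).real {z | bdf z ≤ 2 / n} ≤ Real.pi * (2 / n) ^ 2 :=
    ENNReal.toReal_le_of_le_ofReal (by positivity) (diskMeasure_bdf_le_le hγ (by positivity))
  calc n * √((diskMeasure γ).real {z | bdf z ≤ 2 / n})
      ≤ n * √(Real.pi * (2 / n) ^ 2) := by gcongr
    _ = 2 * √Real.pi := by
      rw [Real.sqrt_mul Real.pi_nonneg, Real.sqrt_sq (by positivity)]
      field_simp

theorem integrable_continuous_mul (hg : Continuous g) (hv : Integrable v (diskMeasure γ)) :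
    Integrable (fun z => g z * v z) (diskMeasure γ) := by
  obtain ⟨C, hC⟩ := (isCompact_closedBall (0 : ℂ) 1).exists_bound_of_continuousOn hg.continuousOn
  exact hv.bdd_mul hg.aestronglyMeasurable
    ((ae_mem_ball γ).mono fun z hz => hC z (ball_subset_closedBall hz))

theorem tendsto_integral_cutoff_mul {G : ℂ → ℂ} (hG : Integrable G (diskMeasure γ)) :
    Tendsto (fun n => ∫ z, (cutoff n (bdf z) : ℂ) * G z ∂diskMeasure γ) atTop
      (𝓝 (∫ z, G z ∂diskMeasure γ)) := by
  refine tendsto_integral_filter_of_dominated_convergence (fun z => ‖G z‖)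
    (Eventually.of_forall fun n =>
      (integrable_continuous_mul (continuous_cutoff_bdf n) hG).aestronglyMeasurable)
    (Eventually.of_forall fun n => Eventually.of_forall fun z => ?_) hG.norm ?_
  · rw [norm_mul]
    exact mul_le_of_le_one_left (norm_nonneg _) (norm_cutoff_le_one n _)
  · filter_upwards [ae_mem_ball γ] with z hz
    have harg : Tendsto (fun n : ℝ => n * bdf z - 1) atTop atTop :=
      tendsto_atTop_add_const_right _ _ (tendsto_id.atTop_mul_const (bdf_pos hz))
    refine tendsto_const_nhds.congr' ?_
    filter_upwards [harg.eventually_ge_atTop 1] with n hn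
    simp only [cutoff, Real.smoothTransition.one_of_one_le hn, Complex.ofReal_one, one_mul]

theorem tendsto_integral_diskOp_cutoff_mul_sub (hγ : 1 ≤ γ) (hv : MemLp v 2 (diskMeasure γ))
    (hg : ContDiff ℝ 2 g) :
    Tendsto (fun n : ℝ => ∫ z, (diskOp γ (fun y => (cutoff n (bdf y) : ℂ) * g y) z -
      (cutoff n (bdf z) : ℂ) * diskOp γ g z) * v z ∂diskMeasure γ) atTop (𝓝 0) := by
  have := isFiniteMeasure_diskMeasure hγ
  obtain ⟨C, hC0, hC⟩ := exists_norm_diskOp_cutoff_mul_sub_le γ hg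
  refine tendsto_integral_mul_of_norm_le_indicator hv (fun n => measurableSet_bdf_le (2 / n))
    (tendsto_diskMeasure_collar hγ) (c := fun n => n * C) (M := 2 * √Real.pi * C) ?_ ?_ ?_ <;>
  filter_upwards [eventually_gt_atTop 0] with n hn
  · positivity
  · rw [mul_right_comm]
    exact mul_le_mul_of_nonneg_right (mul_sqrt_diskMeasure_collar_le hγ hn) hC0
  · exact (ae_mem_ball γ).mono (hC n hn)

theorem integral_add_diskOp_mul_eq_zero (hγ : 1 ≤ γ) (hv : MemLp v 2 (diskMeasure γ))
    (h : ∀ φ ∈ smoothCompact, ∫ z, (φ z + diskOp γ φ z) * v z ∂diskMeasure γ = 0)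
    (hg : ContDiff ℝ ∞ g) (hLg : Continuous (diskOp γ g)) :
    ∫ z, (g z + diskOp γ g z) * v z ∂diskMeasure γ = 0 := by
  have := isFiniteMeasure_diskMeasure hγ
  have hint : Integrable (fun z => (g z + diskOp γ g z) * v z) (diskMeasure γ) :=
    integrable_continuous_mul (hg.continuous.add hLg) (hv.integrable one_le_two)
  have hsum := (tendsto_integral_cutoff_mul hint).add
    (tendsto_integral_diskOp_cutoff_mul_sub hγ hv (hg.of_le (by norm_cast)))
  rw [add_zero] at hsum
  refine tendsto_nhds_unique (hsum.congr' ?_) tendsto_const_nhds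
  filter_upwards [eventually_gt_atTop 0] with n hn
  have hmem := cutoff_mul_mem_smoothCompact hn hg
  have hφ : Integrable (fun z => ((cutoff n (bdf z) : ℂ) * g z +
      diskOp γ (fun y => (cutoff n (bdf y) : ℂ) * g y) z) * v z) (diskMeasure γ) :=
    ((memLp_smoothCompact hmem).add (memLp_diskOp_smoothCompact hmem)).integrable_mul hv
  have hχ := integrable_continuous_mul (continuous_cutoff_bdf n) hint
  have hsplit := integral_sub hφ hχ
  rw [h _ hmem, zero_sub] at hsplit
  rw [← neg_eq_iff_add_eq_zero.1 hsplit.symm]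
  congr 1
  exact integral_congr_ae (Eventually.of_forall fun z => by ring)

end Limit

section Polynomials

theorem eq_zero_of_map_monomial_eq_zero {K : Set ℂ} [CompactSpace K] {E : Type*}
    [AddCommGroup E] [Module ℂ E] [TopologicalSpace E] [T1Space E] {Λ : C(K, ℂ) →L[ℂ] E}
    (h : ∀ a b : ℕ, Λ ⟨fun z => z.1 ^ a * conj (z.1 ^ b), by fun_prop⟩ = 0) : Λ = 0 := by
  have hpoly : (polynomialFunctions K).starClosure.toSubalgebra.toSubmodule ≤ Λ.ker := by
    rw [polynomialFunctions.starClosure_eq_adjoin_X, StarAlgebra.adjoin_toSubalgebra,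
      Algebra.adjoin_eq_span, Submodule.span_le, Set.star_singleton, Set.singleton_union]
    intro F hF
    obtain ⟨a, b, rfl⟩ := (Submonoid.mem_closure_pair _ _ _).1 hF
    refine (congrArg Λ (ContinuousMap.ext fun z => ?_)).trans (h a b)
    simp
  have hdense : Dense ((polynomialFunctions K).starClosure : Set C(K, ℂ)) := by
    rw [dense_iff_closure_eq, ← StarSubalgebra.topologicalClosure_coe,
      polynomialFunctions.starClosure_topologicalClosure, StarSubalgebra.coe_top]
  ext1 F
  exact closure_minimal hpoly Λ.isClosed_ker (hdense F)

/-- Integration against an integrable function, as a functional on continuous functions. -/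
noncomputable def integralMulCLM {X : Type*} [TopologicalSpace X] [CompactSpace X]
    [MeasurableSpace X] [OpensMeasurableSpace X] {μ : Measure X} {v : X → ℂ} (hv : Integrable v μ) :
    C(X, ℂ) →L[ℂ] ℂ :=
  have hint (F : C(X, ℂ)) : Integrable (fun x => F x * v x) μ :=
    hv.bdd_mul F.continuous.aestronglyMeasurable (Eventually.of_forall F.norm_coe_le_norm)
  LinearMap.mkContinuous
    { toFun F := ∫ x, F x * v x ∂μ
      map_add' F G := by
        simp only [ContinuousMap.add_apply, add_mul]
        exact integral_add (hint F) (hint G)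
      map_smul' c F := by
        simp only [ContinuousMap.smul_apply, smul_eq_mul, mul_assoc, integral_const_mul,
          RingHom.id_apply] }
    (∫ x, ‖v x‖ ∂μ) fun F => by
      rw [mul_comm, ← integral_const_mul]
      refine norm_integral_le_of_norm_le (hv.norm.const_mul _) (Eventually.of_forall fun x => ?_)
      rw [norm_mul]
      gcongr
      exact F.norm_coe_le_norm x

theorem integral_continuous_mul_eq_zero {μ : Measure ℂ} {K : Set ℂ} (hK : IsCompact K)
    (hμ : ∀ᵐ z ∂μ, z ∈ K) {v : ℂ → ℂ} (hv : Integrable v μ)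
    (h : ∀ a b : ℕ, ∫ z, z ^ a * conj (z ^ b) * v z ∂μ = 0) {φ : ℂ → ℂ} (hφ : Continuous φ) :
    ∫ z, φ z * v z ∂μ = 0 := by
  have : CompactSpace K := isCompact_iff_compactSpace.1 hK
  have hvK : Integrable (fun z : K => v z) (μ.comap (↑)) :=
    (integrableOn_iff_comap_subtypeVal hK.measurableSet).1 hv.integrableOn
  have hint (F : ℂ → ℂ) : ∫ z : K, F z ∂(μ.comap (↑)) = ∫ z, F z ∂μ := by
    rw [integral_subtype_comap hK.measurableSet, Measure.restrict_eq_self_of_ae_mem hμ]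
  have hzero : integralMulCLM hvK = 0 := eq_zero_of_map_monomial_eq_zero fun a b =>
    (hint fun z => z ^ a * conj (z ^ b) * v z).trans (h a b)
  calc ∫ z, φ z * v z ∂μ = integralMulCLM hvK ⟨fun z => φ z, by fun_prop⟩ :=
      (hint fun z => φ z * v z).symm
    _ = 0 := by rw [hzero, zero_apply]

variable {γ : ℝ} {v : ℂ → ℂ}

theorem mul_integral_monomial_mul_eq (hγ : 1 ≤ γ) (hv : MemLp v 2 (diskMeasure γ))
    (h : ∀ φ ∈ smoothCompact, ∫ z, (φ z + diskOp γ φ z) * v z ∂diskMeasure γ = 0) (a b : ℕ) :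
    (((a + b + γ + 1) ^ 2 + 1 : ℝ) : ℂ) * ∫ z, z ^ a * conj (z ^ b) * v z ∂diskMeasure γ =
      4 * a * b * ∫ z, z ^ (a - 1) * conj (z ^ (b - 1)) * v z ∂diskMeasure γ := by
  have := isFiniteMeasure_diskMeasure hγ
  have hsmooth (a b : ℕ) : ContDiff ℝ ∞ fun z : ℂ => z ^ a * conj (z ^ b) :=
    (contDiff_id.pow a).mul (Complex.conjCLE.contDiff.comp (contDiff_id.pow b))
  have hint (a b : ℕ) : Integrable (fun z => z ^ a * conj (z ^ b) * v z) (diskMeasure γ) :=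
    integrable_continuous_mul (hsmooth a b).continuous (hv.integrable one_le_two)
  have hL : Continuous (diskOp γ fun z => z ^ a * conj (z ^ b)) := by
    rw [funext (diskOp_pow_mul_conj_pow a b)]
    fun_prop
  rw [← sub_eq_zero, ← integral_const_mul, ← integral_const_mul,
    ← integral_sub ((hint _ _).const_mul _) ((hint _ _).const_mul _),
    ← integral_add_diskOp_mul_eq_zero hγ hv h (hsmooth a b) hL]
  refine integral_congr_ae (Eventually.of_forall fun z => ?_)
  simp only [diskOp_pow_mul_conj_pow]
  push_cast
  ring

theorem integral_monomial_mul_eq_zero (hγ : 1 ≤ γ) (hv : MemLp v 2 (diskMeasure γ))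
    (h : ∀ φ ∈ smoothCompact, ∫ z, (φ z + diskOp γ φ z) * v z ∂diskMeasure γ = 0) (a b : ℕ) :
    ∫ z, z ^ a * conj (z ^ b) * v z ∂diskMeasure γ = 0 := by
  have hrec := mul_integral_monomial_mul_eq hγ hv h
  have hne (a b : ℕ) : (((a + b + γ + 1) ^ 2 + 1 : ℝ) : ℂ) ≠ 0 := by
    exact_mod_cast (by positivity : (a + b + γ + 1) ^ 2 + 1 ≠ 0)
  induction a generalizing b with
  | zero =>
    refine (mul_eq_zero.1 ((hrec 0 b).trans ?_)).resolve_left (hne 0 b)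
    rw [Nat.cast_zero, mul_zero, zero_mul, zero_mul]
  | succ a ih =>
    refine (mul_eq_zero.1 ((hrec (a + 1) b).trans ?_)).resolve_left (hne (a + 1) b)
    rw [Nat.add_sub_cancel, ih (b - 1), mul_zero]

theorem ae_eq_zero_of_one_le (hγ : 1 ≤ γ) (hv : MemLp v 2 (diskMeasure γ))
    (h : ∀ φ ∈ smoothCompact, ∫ z, (φ z + diskOp γ φ z) * v z ∂diskMeasure γ = 0) :
    v =ᵐ[diskMeasure γ] 0 := by
  have := isFiniteMeasure_diskMeasure hγ
  refine ae_eq_zero_of_integral_smoothCompact_mul hv fun φ hφ => ?_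
  exact integral_continuous_mul_eq_zero (isCompact_closedBall 0 1)
    ((ae_mem_ball γ).mono fun z hz => ball_subset_closedBall hz) (hv.integrable one_le_two)
    (integral_monomial_mul_eq_zero hγ hv h) hφ.1.continuous

end Polynomials

section Conjugation

variable {γ : ℝ} {v : ℂ → ℂ}

theorem diskMeasure_absolutelyContinuous (γ δ : ℝ) : diskMeasure γ ≪ diskMeasure δ :=
  Measure.ae_le_iff_absolutelyContinuous.1 fun _ hs =>
    (ae_diskMeasure_iff γ _).2 ((ae_diskMeasure_iff δ _).1 hs)

theorem memLp_rpow_bdf_mul (hv : MemLp v 2 (diskMeasure γ)) :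
    MemLp (fun z => ((bdf z ^ γ : ℝ) : ℂ) * v z) 2 (diskMeasure (-γ)) := by
  have hmeas : AEStronglyMeasurable (fun z => ((bdf z ^ γ : ℝ) : ℂ) * v z) (diskMeasure (-γ)) := by
    have hpow : Measurable fun z : ℂ => ((bdf z ^ γ : ℝ) : ℂ) := by
      unfold bdf
      fun_prop
    exact hpow.aestronglyMeasurable.mul (hv.1.mono_ac (diskMeasure_absolutelyContinuous _ _))
  have hsq := (memLp_two_iff_integrable_sq_norm hv.1).1 hv
  rw [integrable_diskMeasure_iff] at hsq
  rw [memLp_two_iff_integrable_sq_norm hmeas, integrable_diskMeasure_iff]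
  refine hsq.congr_fun (fun z hz => ?_) measurableSet_ball
  have hpos := Real.rpow_pos_of_pos (bdf_pos hz) γ
  simp only [norm_mul, Complex.norm_real, Real.norm_of_nonneg hpos.le, smul_eq_mul,
    Real.rpow_neg (bdf_pos hz).le]
  field_simp

theorem integral_add_diskOp_neg_mul (γ : ℝ) (v : ℂ → ℂ) {ψ : ℂ → ℂ} (hψ : ContDiff ℝ 2 ψ) :
    ∫ z, (ψ z + diskOp (-γ) ψ z) * (((bdf z ^ γ : ℝ) : ℂ) * v z) ∂diskMeasure (-γ) =
      ∫ z, (((bdf z ^ (-γ) : ℝ) : ℂ) * ψ z +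
        diskOp γ (fun y => ((bdf y ^ (-γ) : ℝ) : ℂ) * ψ y) z) * v z ∂diskMeasure γ := by
  rw [integral_diskMeasure, integral_diskMeasure]
  refine setIntegral_congr_fun measurableSet_ball fun z hz => ?_
  have hne : ((bdf z ^ γ : ℝ) : ℂ) ≠ 0 := by
    exact_mod_cast (Real.rpow_pos_of_pos (bdf_pos hz) γ).ne'
  simp only [diskOp_rpow_mul (bdf_pos hz).ne' hψ.contDiffAt, Real.rpow_neg (bdf_pos hz).le,
    Complex.real_smul]
  push_cast
  field_simp

theorem ae_eq_zero_of_integral_add_diskOp_mul (hγ : 1 ≤ |γ|) (hv : MemLp v 2 (diskMeasure γ))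
    (h : ∀ φ ∈ smoothCompact, ∫ z, (φ z + diskOp γ φ z) * v z ∂diskMeasure γ = 0) :
    v =ᵐ[diskMeasure γ] 0 := by
  rcases le_abs.1 hγ with hpos | hneg
  · exact ae_eq_zero_of_one_le hpos hv h
  have hzero := ae_eq_zero_of_one_le hneg (memLp_rpow_bdf_mul hv) fun ψ hψ =>
    (integral_add_diskOp_neg_mul γ v (hψ.1.of_le (by norm_cast))).trans
      (h _ (mul_mem_smoothCompact (rpow_bdf_mem_smoothInterior (-γ)) hψ))
  filter_upwards [(diskMeasure_absolutelyContinuous γ (-γ)).ae_eq hzero, ae_mem_ball γ]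
    with z hz hball
  have hne : ((bdf z ^ γ : ℝ) : ℂ) ≠ 0 := by
    exact_mod_cast (Real.rpow_pos_of_pos (bdf_pos hball) γ).ne'
  exact (mul_eq_zero.1 hz).resolve_left hne

end Conjugation

section SelfAdjointness

variable {γ : ℝ}

theorem eq_zero_of_forall_inner_add_compactOp_eq_zero (hγ : 1 ≤ |γ|) {v : DiskL2 γ}
    (hv : ∀ u : (compactOp γ).domain, inner ℂ ((u : DiskL2 γ) + compactOp γ u) v = 0) : v = 0 := by
  have hzero := ae_eq_zero_of_integral_add_diskOp_mul hγ (Lp.memLp v).star fun φ hφ => by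
    have hmem := memLp_smoothCompact (γ := γ) hφ
    have hLmem := memLp_diskOp_smoothCompact (γ := γ) hφ
    obtain ⟨u, hu, hLu⟩ :=
      (compactOp γ).mem_graph_iff.1 (toLp_mem_graph_opOn hφ hmem hLmem)
    have horth := congrArg conj (hv u)
    rw [hu, hLu, ← MemLp.toLp_add hmem hLmem,
      inner_eq_integral (MemLp.coeFn_toLp _) EventuallyEq.rfl, ← integral_conj] at horth
    simpa [mul_comm] using horth
  rw [Lp.eq_zero_iff_ae_eq_zero]
  exact hzero.mono fun z hz => star_eq_zero.1 hz

theorem adjoint_compactOp_eq_closure (hγ : 1 ≤ |γ|) :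
    (compactOp γ).adjoint = (compactOp γ).closure :=
  adjoint_eq_closure (dense_domain_compactOp γ) isFormalAdjoint_opOn_compactOp
    re_form_compactOp_nonneg
    (denseRange_add_apply fun _ => eq_zero_of_forall_inner_add_compactOp_eq_zero hγ)

theorem smoothCompact_le_smoothFlat : smoothCompact ≤ smoothFlat := by
  intro f hf
  refine ⟨hf.1.contDiffOn, fun n z hz => ?_⟩
  have hz_notMem : z ∉ tsupport f := fun hmem => (mem_ball_zero_iff.1 (hf.2.2 hmem)).ne hz
  have hzero : f =ᶠ[𝓝 z] 0 := notMem_tsupport_iff_eventuallyEq.1 hz_notMem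
  rw [(hzero.filter_mono nhdsWithin_le_nhds).iteratedFDerivWithin_eq hzero.eq_of_nhds]
  exact congrFun iteratedFDerivWithin_fun_zero z

theorem compactOp_le_preminimal : compactOp γ ≤ preminimal γ := by
  refine LinearPMap.le_of_le_graph ?_
  rw [compactOp, preminimal, opOn_graph, opOn_graph]
  rintro p ⟨f, hf, h⟩
  exact ⟨f, smoothCompact_le_smoothFlat hf, h⟩

theorem preminimal_isClosable : (preminimal γ).IsClosable :=
  isClosable_of_isFormalAdjoint (dense_domain_compactOp γ) isFormalAdjoint_opOn_compactOp.symm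

theorem minimal_eq_closure_compactOp (hγ : 1 ≤ |γ|) : minimal γ = (compactOp γ).closure :=
  closure_eq_of_isFormalAdjoint (dense_domain_compactOp γ) (adjoint_compactOp_eq_closure hγ)
    compactOp_le_preminimal isFormalAdjoint_opOn_compactOp.symm

theorem isSelfAdjoint_minimal (hγ : 1 ≤ |γ|) : IsSelfAdjoint (minimal γ) := by
  rw [minimal_eq_closure_compactOp hγ]
  exact isSelfAdjoint_closure (dense_domain_compactOp γ) (adjoint_compactOp_eq_closure hγ)

theorem isFriedrichsExtension_minimal (hγ : 1 ≤ |γ|) :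
    IsFriedrichsExtension (compactOp γ) (minimal γ) := by
  rw [minimal_eq_closure_compactOp hγ]
  exact isFriedrichsExtension_closure (dense_domain_compactOp γ) isFormalAdjoint_opOn_compactOp
    re_form_compactOp_nonneg (adjoint_compactOp_eq_closure hγ)

theorem eq_minimal_of_isSelfAdjoint (hγ : 1 ≤ |γ|) {T : DiskL2 γ →ₗ.[ℂ] DiskL2 γ}
    (hT : IsSelfAdjoint T) (h : preminimal γ ≤ T) : T = minimal γ :=
  eq_of_isSelfAdjoint_of_le (isSelfAdjoint_minimal hγ) hT (closure_le_of_isClosed hT.isClosed h)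

end SelfAdjointness

end DiskOperator

theorem theorem2p2 (γ : ℝ) (hγ : 1 ≤ |γ|) :
    (∀ f ∈ DiskOperator.smoothFlat,
      MeasureTheory.MemLp f 2 (DiskOperator.diskMeasure γ) ∧
      MeasureTheory.MemLp (DiskOperator.diskOp γ f) 2 (DiskOperator.diskMeasure γ)) ∧
    (DiskOperator.preminimal γ).IsClosable ∧
    IsSelfAdjoint (DiskOperator.minimal γ) ∧
    DiskOperator.IsFriedrichsExtension (DiskOperator.compactOp γ) (DiskOperator.minimal γ) ∧
    (∀ T : DiskOperator.DiskL2 γ →ₗ.[ℂ] DiskOperator.DiskL2 γ,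
      (IsSelfAdjoint T ∧ DiskOperator.preminimal γ ≤ T) ↔ T = DiskOperator.minimal γ) := by
  refine ⟨fun f hf => ⟨DiskOperator.memLp_smoothFlat hf, DiskOperator.memLp_diskOp_smoothFlat hf⟩,
    DiskOperator.preminimal_isClosable, DiskOperator.isSelfAdjoint_minimal hγ,
    DiskOperator.isFriedrichsExtension_minimal hγ, fun T => ⟨fun h => ?_, ?_⟩⟩
  · exact DiskOperator.eq_minimal_of_isSelfAdjoint hγ h.1 h.2
  · rintro rfl
    exact ⟨DiskOperator.isSelfAdjoint_minimal hγ, LinearPMap.le_closure _⟩
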